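/- Let $f\in\mathbb{R}(z)$ be a rational function of degree two with real coefficients, regarded as a self-map of the Riemann sphere $\hat{\mathbb{C}}=\mathbb{C}\cup\{\infty\}$; it maps the circle $\hat{\mathbb{R}}=\mathbb{R}\cup\{\infty\}$ into itself. The following are equivalent: 1. the restriction $f|_{\hat{\mathbb{R}}}:\hat{\mathbb{R}}\to\hat{\mathbb{R}}$ is surjective; 2. the critical orbits of $f$ do not meet $\hat{\mathbb{R}}$, that is, $f^{\circ n}(c)\notin\hat{\mathbb{R}}$ for every critical point $c\in\hat{\mathbb{C}}$ of $f$ and every $n\ge 0$; 3. the restriction $f|_{\hat{\mathbb{R}}}:\hat{\mathbb{R}}\to\hat{\mathbb{R}}$ is a covering map. If these conditions hold, then the Julia set $\mathcal{J}(f)\subset\hat{\mathbb{C}}$ (the complement of the largest open set on which the iterates of $f$ form an equicontinuous family for the spherical metric) is either the whole circle $\hat{\mathbb{R}}$ or a Cantor set contained in $\hat{\mathbb{R}}$, and the real entropy $h_{\mathbb{R}}(f)$, that is, the topological entropy of $f|_{\hat{\mathbb{R}}}:\hat{\mathbb{R}}\to\hat{\mathbb{R}}$, equals $\log 2$. -/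

import Mathlib

open Polynomial Topology Set

namespace RealQuadratic

noncomputable section

/-- The degree of a rational map `f = P / Q` in lowest terms: `max (deg P) (deg Q)`. -/
def mapDegree {F : Type*} [Field F] (f : RatFunc F) : ℕ :=
  max f.num.natDegree f.denom.natDegree

open Classical in
/-- The self-map of the projective line `K ∪ {∞}` induced by a rational function `f = P / Q`
(in lowest terms) with coefficients in a subfield `F` of `K`. A finite point `z` goes to
`P(z) / Q(z)`, or to `∞` if `Q(z) = 0`; the point `∞` goes to the limit of `P / Q` at infinity,
which is `∞` if `deg Q < deg P`, and otherwise the quotient of the coefficients of degree `deg Q`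
of `P` and `Q`. -/
def projMap {F : Type*} [Field F] (K : Type*) [Field K] [Algebra F K] (f : RatFunc F)
    (z : OnePoint K) : OnePoint K :=
  z.elim
    (if f.denom.natDegree < f.num.natDegree then OnePoint.infty
      else OnePoint.some
        (algebraMap F K (f.num.coeff f.denom.natDegree / f.denom.coeff f.denom.natDegree)))
    (fun t => if aeval t f.denom = 0 then OnePoint.infty
      else OnePoint.some (aeval t f.num / aeval t f.denom))

/-- The map `f` induced by a real rational function on the Riemann sphere `ℂ ∪ {∞}`. -/
abbrev sphereMap (f : RatFunc ℝ) : OnePoint ℂ → OnePoint ℂ := projMap ℂ f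

/-- The restriction of `f` to the real circle `ℝ ∪ {∞}`. -/
abbrev circleMap (f : RatFunc ℝ) : OnePoint ℝ → OnePoint ℝ := projMap ℝ f

/-- The inclusion of the real circle `ℝ ∪ {∞}` in the Riemann sphere. -/
def circleIncl : OnePoint ℝ → OnePoint ℂ := OnePoint.map (fun x : ℝ => (x : ℂ))

/-- The real circle `ℝ ∪ {∞}` as a subset of the Riemann sphere. -/
def realCircle : Set (OnePoint ℂ) := range circleIncl

/-- `circleMap f` is indeed the restriction of `sphereMap f` to the real circle. -/
theorem circleIncl_circleMap (f : RatFunc ℝ) (x : OnePoint ℝ) :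
    circleIncl (circleMap f x) = sphereMap f (circleIncl x) := by
  have key : ∀ (p : ℝ[X]) (t : ℝ), aeval (t : ℂ) p = ((aeval t p : ℝ) : ℂ) := fun p t =>
    aeval_algebraMap_apply ℂ t p
  induction x using OnePoint.rec with
  | infty =>
    simp only [circleIncl, circleMap, sphereMap, projMap, OnePoint.map_infty, OnePoint.elim_infty]
    split_ifs <;> simp
  | coe t =>
    simp only [circleIncl, circleMap, sphereMap, projMap, OnePoint.map_some, OnePoint.elim_some,
      key, Complex.ofReal_eq_zero]
    split_ifs <;> simp

/-- The standard local coordinate of the Riemann sphere around `b`: it is `z` when `b` is finite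
and `1 / z` when `b = ∞`. (Its value at the one point outside the chart domain is irrelevant.) -/
def coord (b z : OnePoint ℂ) : ℂ :=
  b.elim (z.elim 0 (fun t => t⁻¹)) (fun _ => z.elim 0 (fun t => t))

open Classical in
/-- The inverse of the local coordinate around `b`. -/
def coordInv (b : OnePoint ℂ) (t : ℂ) : OnePoint ℂ :=
  b.elim (if t = 0 then OnePoint.infty else OnePoint.some t⁻¹) (fun _ => OnePoint.some t)

/-- `c` is a critical point of `g`: the derivative of `g` at `c`, read in the local coordinates
around `c` and around `g c`, exists and vanishes. -/
def IsCriticalPoint (g : OnePoint ℂ → OnePoint ℂ) (c : OnePoint ℂ) : Prop :=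
  HasDerivAt (fun t => coord (g c) (g (coordInv c t))) 0 (coord c c)

/-- The Fatou set of a self-map `g` of a compact Hausdorff space (with its unique uniformity, for
the Riemann sphere that of the spherical metric): the largest open set on which the family of the
iterates of `g` is equicontinuous. -/
def fatouSet {X : Type*} [TopologicalSpace X] [CompactSpace X] [T2Space X] (g : X → X) : Set X :=
  letI : UniformSpace X := uniformSpaceOfCompactR1
  {z | ∃ U : Set X, IsOpen U ∧ z ∈ U ∧ EquicontinuousOn (fun n : ℕ => g^[n]) U}

/-- The Julia set: the complement of the Fatou set. -/
def juliaSet {X : Type*} [TopologicalSpace X] [CompactSpace X] [T2Space X] (g : X → X) : Set X :=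
  (fatouSet g)ᶜ

/-- A Cantor set: a set homeomorphic to the ternary Cantor set. -/
def IsCantorSet {X : Type*} [TopologicalSpace X] (S : Set X) : Prop :=
  Nonempty (S ≃ₜ cantorSet)

/-- The topological entropy of a self-map of a compact Hausdorff space (Bowen's definition, for the
unique uniformity of the space). -/
def topEntropy {X : Type*} [TopologicalSpace X] [CompactSpace X] [T2Space X] (g : X → X) : EReal :=
  letI : UniformSpace X := uniformSpaceOfCompactR1
  Dynamics.coverEntropy g univ

/-- The real entropy of `f`: the topological entropy of its restriction to the real circle. -/
def realEntropy (f : RatFunc ℝ) : EReal := topEntropy (circleMap f)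

end

end RealQuadratic

/-! Write `f = P / Q` in homogeneous coordinates as a pair of binary quadratic forms, giving a map
`F` of the plane. The determinant of `F u` and `F v` is the determinant of `u` and `v` times a
symmetric bilinear form, the polarisation of half the Jacobian (`QuadPair.lift_cross`). The zeros of
that second factor give the other point of each fibre, hence an involution `τ` induced by a
traceless linear map, whose fixed points are the critical points. A quarter of the discriminant of
the critical form is the resultant `res` of `P` and `Q`; it is nonzero, and its sign decides
everything. If `res > 0`, there is a real critical point, and some real value has no real preimage.
If `res < 0`, the critical form is definite, `τ` acts freely on the circle, every real value has
real preimages, and the restriction is a double covering. The Hermitian extension of the critical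
form is then definite too, so the circle is totally invariant and the critical orbits stay off it.

Entropy. A free `τ` moves all points by a definite amount, so the `2 ^ n` points of a fibre of the
`n`-th iterate are separated before time `n`; this gives the lower bound. Conversely, finitely many
points cut the circle into small arcs, and their preimages up to time `n`, of order `2 ^ n` in
number, form a dynamical cover.

Julia set. It is the set of circle points all of whose neighbourhoods are eventually mapped onto the
circle (`juliaSet_sphereMap`). Off the circle the iterates take values in half-planes, hence are
normal. If a neighbourhood of a circle point never covers the circle, the `n`-th iterate omits on it
a whole fibre `{u, τ u}`; a square root then maps the values on a complex disc into the unit disc,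
uniformly in `n`, because `u` and `τ u` stay apart. The expanding set is closed, nonempty, perfect
and completely invariant. It is the whole circle as soon as it has interior; otherwise it is totally
disconnected, hence a Cantor set by Brouwer's theorem. -/

namespace RealQuadratic

open Filter Uniformity UniformSpace

/-! ### Characterisation of the Cantor set -/

section Cantor

variable {Y : Type*}

open Classical in
/-- The nested pieces selected by a binary sequence `s`, when at stage `n` a piece `A` is cut by
the set `C n A`. -/
noncomputable def cutPiece (C : ℕ → Set Y → Set Y) (s : ℕ → Prop) : ℕ → Set Y
  | 0 => univ
  | n + 1 => if s n then cutPiece C s n ∩ C n (cutPiece C s n)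
      else cutPiece C s n \ C n (cutPiece C s n)

open Classical in
/-- The nested pieces which contain the point `x`. -/
noncomputable def cutPieceAt (C : ℕ → Set Y → Set Y) (x : Y) : ℕ → Set Y
  | 0 => univ
  | n + 1 => if x ∈ C n (cutPieceAt C x n) then cutPieceAt C x n ∩ C n (cutPieceAt C x n)
      else cutPieceAt C x n \ C n (cutPieceAt C x n)

theorem mem_cutPieceAt (C : ℕ → Set Y → Set Y) (x : Y) (n : ℕ) : x ∈ cutPieceAt C x n := by
  induction n with
  | zero => trivial
  | succ n ih =>
    simp only [cutPieceAt]
    split_ifs with h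
    · exact ⟨ih, h⟩
    · exact ⟨ih, h⟩

theorem cutPiece_eq_cutPieceAt (C : ℕ → Set Y → Set Y) (x : Y) (n : ℕ) :
    cutPiece C (fun k => x ∈ C k (cutPieceAt C x k)) n = cutPieceAt C x n := by
  induction n with
  | zero => rfl
  | succ n ih => simp only [cutPiece, cutPieceAt, ih]

theorem cutPiece_congr (C : ℕ → Set Y → Set Y) {s t : ℕ → Prop} (n : ℕ)
    (h : ∀ k < n, s k ↔ t k) : cutPiece C s n = cutPiece C t n := by
  induction n with
  | zero => rfl
  | succ n ih =>
    have h1 := ih fun k hk => h k (by omega)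
    have h2 := h n (by omega)
    by_cases ht : t n
    · simp only [cutPiece, h1, if_pos ht, if_pos (h2.2 ht)]
    · simp only [cutPiece, h1, if_neg ht, if_neg (mt h2.1 ht)]

theorem cutPiece_antitone (C : ℕ → Set Y → Set Y) (s : ℕ → Prop) : Antitone (cutPiece C s) := by
  refine antitone_nat_of_succ_le fun n => ?_
  simp only [cutPiece]
  split_ifs
  · exact inter_subset_left
  · exact sdiff_subset

variable [TopologicalSpace Y] [CompactSpace Y] [T2Space Y]

/-- **Brouwer's theorem**: a nonempty compact metrisable totally disconnected space without isolated
points is homeomorphic to the Cantor space. -/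
theorem nonempty_homeomorph_cantorSpace [SecondCountableTopology Y] [TotallyDisconnectedSpace Y]
    [Nonempty Y] (hperf : ∀ x : Y, ¬ IsOpen {x}) : Nonempty (Y ≃ₜ (ℕ → Bool)) := by
  classical
  have : Countable (TopologicalSpace.Clopens Y) :=
    TopologicalSpace.Clopens.countable_iff_secondCountable.2 inferInstance
  obtain ⟨B, hB⟩ := exists_surjective_nat (TopologicalSpace.Clopens Y)
  have sep : ∀ x y : Y, x ≠ y → ∃ n, x ∈ B n ∧ y ∉ B n := by
    intro x y hxy
    obtain ⟨U, hU, hx, hy⟩ := exists_isClopen_of_totally_separated hxy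
    obtain ⟨n, hn⟩ := hB ⟨U, hU⟩
    refine ⟨n, ?_, ?_⟩
    · rw [hn]; exact hx
    · rw [hn]; exact hy
  -- The cut is `B n` when it splits `A`, and otherwise some clopen set that does, which exists
  -- because no point is isolated. Both halves are thus always nonempty. The value `∅` is a dummy
  -- for sets `A` that never occur.
  have cut : ∀ (n : ℕ) (A : Set Y), ∃ C : Set Y, IsClopen A → A.Nonempty →
      IsClopen C ∧ (A ∩ C).Nonempty ∧ (A \ C).Nonempty ∧
        ∀ x ∈ A, ∀ y ∈ A, x ∈ B n → y ∉ B n → x ∈ C ∧ y ∉ C := by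
    intro n A
    by_cases h : (A ∩ B n).Nonempty ∧ (A \ B n).Nonempty
    · exact ⟨B n, fun _ _ => ⟨(B n).isClopen, h.1, h.2, fun x _ y _ hx hy => ⟨hx, hy⟩⟩⟩
    · by_cases hA : IsClopen A ∧ A.Nonempty
      · obtain ⟨hA, x, hx⟩ := hA
        have : ∃ y ∈ A, y ≠ x := by
          by_contra! hcon
          exact hperf x ((Subset.antisymm (fun y hy => hcon y hy)
            (singleton_subset_iff.2 hx) : A = {x}) ▸ hA.isOpen)
        obtain ⟨y, hy, hyx⟩ := this
        obtain ⟨k, hk, hk'⟩ := sep x y hyx.symm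
        refine ⟨B k, fun _ _ => ⟨(B k).isClopen, ⟨x, hx, hk⟩, ⟨y, hy, hk'⟩, ?_⟩⟩
        intro u hu v hv hun hvn
        exact absurd ⟨⟨u, hu, hun⟩, ⟨v, hv, hvn⟩⟩ h
      · exact ⟨∅, fun h1 h2 => absurd ⟨h1, h2⟩ hA⟩
  choose C hC using cut
  have clopen : ∀ (s : ℕ → Prop) (n : ℕ), IsClopen (cutPiece C s n) ∧ (cutPiece C s n).Nonempty := by
    intro s n
    induction n with
    | zero => exact ⟨isClopen_univ, univ_nonempty⟩
    | succ n ih =>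
      obtain ⟨h1, h2, h3, -⟩ := hC n _ ih.1 ih.2
      simp only [cutPiece]
      split_ifs
      · exact ⟨ih.1.inter h1, h2⟩
      · exact ⟨ih.1.diff h1, h3⟩
  -- Either `B n` made the cut or it did not split the piece; from stage `n + 1` on no piece is
  -- split by it. As the `B n` separate points, nested pieces shrink to a single point.
  have same : ∀ (s : ℕ → Prop) (n : ℕ) (x y : Y), x ∈ cutPiece C s (n + 1) →
      y ∈ cutPiece C s (n + 1) → x ∈ B n → y ∈ B n := by
    intro s n x y hx hy hxB
    by_contra hyB
    have h := (hC n _ (clopen s n).1 (clopen s n).2).2.2.2 x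
      (cutPiece_antitone C s n.le_succ hx) y (cutPiece_antitone C s n.le_succ hy) hxB hyB
    simp only [cutPiece] at hx hy
    split_ifs at hx hy
    · exact h.2 hy.2
    · exact hx.2 h.1
  have inter : ∀ s : ℕ → Prop, ∃ x, ∀ n, x ∈ cutPiece C s n := by
    intro s
    obtain ⟨x, hx⟩ := IsCompact.nonempty_iInter_of_sequence_nonempty_isCompact_isClosed
      (cutPiece C s) (fun n => cutPiece_antitone C s n.le_succ) (fun n => (clopen s n).2)
      (clopen s 0).1.isClosed.isCompact (fun n => (clopen s n).1.isClosed)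
    exact ⟨x, fun n => mem_iInter.1 hx n⟩
  choose φ hφ using fun s : ℕ → Bool => inter (fun n => s n = true)
  have uniq : ∀ (s : ℕ → Bool) (x : Y), (∀ n, x ∈ cutPiece C (fun n => s n = true) n) →
      φ s = x := by
    intro s x hx
    by_contra hne
    obtain ⟨n, hn, hn'⟩ := sep _ _ hne
    exact hn' (same _ n _ _ (hφ s (n + 1)) (hx (n + 1)) hn)
  have cont : Continuous φ := by
    refine continuous_iff_continuousAt.2 fun s => ?_
    intro U hU
    obtain ⟨V, hVU, hV, hVs⟩ := mem_nhds_iff.1 hU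
    obtain ⟨W, hW, hsW, hWV⟩ := compact_exists_isClopen_in_isOpen hV hVs
    obtain ⟨n, hn⟩ := hB ⟨W, hW⟩
    have hev : ∀ᶠ t in 𝓝 s, ∀ k < n + 1, t k = s k := by
      refine (Filter.eventually_all_finite (finite_lt_nat (n + 1))).2 fun k _ => ?_
      exact (continuous_apply k).continuousAt.eventually
        (show ∀ᶠ b in 𝓝 (s k), b = s k by simp [nhds_discrete])
    refine hev.mono fun t ht => ?_
    have h1 : φ t ∈ cutPiece C (fun n => s n = true) (n + 1) := by
      rw [cutPiece_congr C (t := fun n => t n = true) (n + 1) fun k hk => by rw [ht k hk]]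
      exact hφ t (n + 1)
    have := same _ n _ _ (hφ s (n + 1)) h1 (by rw [hn]; exact hsW)
    rw [hn] at this
    exact hVU (hWV this)
  have inj : Function.Injective φ := by
    intro s t hst
    by_contra hne
    have hex : ∃ n, s n ≠ t n := by
      by_contra! hcon
      exact hne (funext hcon)
    have hmin : ∀ k < Nat.find hex, s k = t k := fun k hk => by
      by_contra h
      exact Nat.find_min hex hk h
    have h1 := hφ s (Nat.find hex + 1)
    have h2 := hφ t (Nat.find hex + 1)
    have h3 := Nat.find_spec hex
    have h4 := cutPiece_congr C (s := fun n => s n = true) (t := fun n => t n = true)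
      (Nat.find hex) fun k hk => by rw [hmin k hk]
    rw [hst] at h1
    simp only [cutPiece, h4] at h1 h2
    split_ifs at h1 h2 with h5 h6 h6
    · exact h3 (h5.trans h6.symm)
    · exact h2.2 h1.2
    · exact h1.2 h2.2
    · rw [Bool.not_eq_true] at h5 h6
      exact h3 (h5.trans h6.symm)
  have surj : Function.Surjective φ := by
    intro x
    refine ⟨fun n => decide (x ∈ C n (cutPieceAt C x n)), uniq _ x fun n => ?_⟩
    have := cutPiece_eq_cutPieceAt C x n
    simp only [decide_eq_true_eq]
    rw [this]
    exact mem_cutPieceAt C x n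
  exact ⟨(Continuous.homeoOfEquivCompactToT2 (f := Equiv.ofBijective φ ⟨inj, surj⟩) cont).symm⟩

end Cantor

/-! ### Two-to-one maps with a free deck involution -/

/-- `g` is a continuous surjection whose fibres are the orbits of a continuous involution `τ`
without fixed points. -/
structure IsDoubleCover {X : Type*} [TopologicalSpace X] (g τ : X → X) : Prop where
  continuous_map : Continuous g
  continuous_deck : Continuous τ
  deck_deck : ∀ x, τ (τ x) = x
  deck_ne : ∀ x, τ x ≠ x
  map_eq_iff : ∀ x y, g x = g y ↔ y = x ∨ y = τ x
  surjective : Function.Surjective g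

/-- The points all of whose neighbourhoods are eventually mapped onto the whole space. -/
def expandingSet {X : Type*} [TopologicalSpace X] (g : X → X) : Set X :=
  {x | ∀ A : Set X, IsOpen A → x ∈ A → ∃ n : ℕ, g^[n] '' A = univ}

namespace IsDoubleCover

section Topological

variable {X : Type*} [TopologicalSpace X] {g τ : X → X} (h : IsDoubleCover g τ)

include h

theorem map_deck (x : X) : g (τ x) = g x := ((h.map_eq_iff x (τ x)).2 (Or.inr rfl)).symm

/-- By compactness `g` is a quotient map, and the saturation of an open set `A` is the open set `A ∪
τ ⁻¹' A`. -/
theorem isOpenMap [CompactSpace X] [T2Space X] : IsOpenMap g := by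
  intro A hA
  have hq : IsQuotientMap g := h.continuous_map.isClosedMap.isQuotientMap h.continuous_map
    h.surjective
  rw [← hq.isOpen_preimage]
  have : g ⁻¹' (g '' A) = A ∪ τ ⁻¹' A := by
    ext x
    constructor
    · rintro ⟨a, ha, hax⟩
      rcases (h.map_eq_iff x a).1 hax.symm with rfl | rfl
      · exact Or.inl ha
      · exact Or.inr ha
    · rintro (hx | hx)
      · exact ⟨x, hx, rfl⟩
      · exact ⟨τ x, hx, h.map_deck x⟩
  rw [this]
  exact hA.union (hA.preimage h.continuous_deck)

/-- A neighbourhood of `x` disjoint from its image under `τ` is mapped injectively, so `g` is a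
local homeomorphism; between compact Hausdorff spaces this suffices. -/
theorem isCoveringMap [CompactSpace X] [T2Space X] : IsCoveringMap g := by
  rw [← isLocalHomeomorph_iff_isCoveringMap, isLocalHomeomorph_iff_isOpenEmbedding_restrict]
  intro x
  obtain ⟨U, V, hU, hV, hxU, hxV, hUV⟩ := t2_separation (h.deck_ne x).symm
  have hW : IsOpen (U ∩ τ ⁻¹' V) := hU.inter (hV.preimage h.continuous_deck)
  refine ⟨U ∩ τ ⁻¹' V, hW.mem_nhds ⟨hxU, hxV⟩,
    .of_continuous_injective_isOpenMap h.continuous_map.continuousOn.domRestrict ?_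
      (h.isOpenMap.domRestrict hW)⟩
  refine injOn_iff_injective.1 fun a ha b hb hab => ?_
  rcases (h.map_eq_iff a b).1 hab with h1 | h1
  · exact h1.symm
  · exact absurd hb.1 (fun hbU => disjoint_left.1 hUV hbU (h1 ▸ ha.2))

theorem exists_finset_iterate_eq (n : ℕ) (p : X) :
    ∃ S : Finset X, S.card = 2 ^ n ∧ ∀ x ∈ S, g^[n] x = p := by
  classical
  induction n generalizing p with
  | zero => exact ⟨{p}, by simp, by simp⟩
  | succ n ih =>
    obtain ⟨q, rfl⟩ := h.surjective p
    obtain ⟨S, hS, hS'⟩ := ih q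
    obtain ⟨T, hT, hT'⟩ := ih (τ q)
    refine ⟨S ∪ T, ?_, ?_⟩
    · rw [Finset.card_union_of_disjoint, hS, hT, pow_succ, mul_two]
      refine Finset.disjoint_left.2 fun x hx hx' => h.deck_ne q ?_
      rw [← hS' x hx, hS' x hx, ← hT' x hx', hS' x hx]
    · intro x hx
      rw [Function.iterate_succ_apply']
      rcases Finset.mem_union.1 hx with hx | hx
      · rw [hS' x hx]
      · rw [hT' x hx, h.map_deck]

/-- At the last time when the two orbits differ they lie in one fibre, so `τ` exchanges them. -/
theorem eq_of_iterate_eq {n : ℕ} {x y : X} (hxy : g^[n] x = g^[n] y)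
    (hk : ∀ k < n, g^[k] y ≠ τ (g^[k] x)) : x = y := by
  induction n with
  | zero => exact hxy
  | succ n ih =>
    rw [Function.iterate_succ_apply', Function.iterate_succ_apply'] at hxy
    rcases (h.map_eq_iff _ _).1 hxy with h1 | h1
    · exact ih h1.symm fun k hk' => hk k (by omega)
    · exact absurd h1 (hk n (by omega))

/-! #### The expanding set -/

omit h in
theorem isClosed_expandingSet (g : X → X) : IsClosed (expandingSet g) := by
  refine isClosed_of_closure_subset fun x hx A hA hxA => ?_
  obtain ⟨y, hyA, hy⟩ := mem_closure_iff.1 hx A hA hxA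
  exact hy A hA hyA

theorem map_mem_expandingSet {x : X} (hx : x ∈ expandingSet g) : g x ∈ expandingSet g := by
  intro A hA hxA
  obtain ⟨n, hn⟩ := hx (g ⁻¹' A) (hA.preimage h.continuous_map) hxA
  refine ⟨n, ?_⟩
  rw [← image_preimage_eq A h.surjective, ← image_comp, ← Function.iterate_succ,
    Function.iterate_succ', image_comp, hn, image_univ, h.surjective.range_eq]

theorem iterate_mem_expandingSet {x : X} (hx : x ∈ expandingSet g) (n : ℕ) :
    g^[n] x ∈ expandingSet g := by
  induction n with
  | zero => exact hx
  | succ n ih => rw [Function.iterate_succ_apply']; exact h.map_mem_expandingSet ih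

variable [CompactSpace X] [T2Space X]

theorem mem_expandingSet_of_map {x : X} (hx : g x ∈ expandingSet g) : x ∈ expandingSet g := by
  intro A hA hxA
  obtain ⟨n, hn⟩ := hx (g '' A) (h.isOpenMap A hA) ⟨x, hxA, rfl⟩
  refine ⟨n + 1, ?_⟩
  rw [Function.iterate_succ, image_comp, hn]

theorem mem_expandingSet_of_iterate {x : X} {n : ℕ} (hx : g^[n] x ∈ expandingSet g) :
    x ∈ expandingSet g := by
  induction n with
  | zero => exact hx
  | succ n ih =>
    rw [Function.iterate_succ_apply'] at hx
    exact ih (h.mem_expandingSet_of_map hx)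

omit [CompactSpace X] [T2Space X] in
-- Some iterate spreads `A` over the whole space, and forward invariance keeps its image inside the
-- expanding set.
theorem expandingSet_eq_univ {A : Set X} (hA : IsOpen A) (hne : A.Nonempty)
    (hsub : A ⊆ expandingSet g) : expandingSet g = univ := by
  obtain ⟨x, hx⟩ := hne
  obtain ⟨n, hn⟩ := hsub hx A hA hx
  refine eq_univ_of_univ_subset (hn ▸ ?_)
  rintro _ ⟨y, hy, rfl⟩
  exact h.iterate_mem_expandingSet (hsub hy) n

/-- If `x` were the only expanding point of `A`, an iterate of `A` covering the space would leave
`g^[n] x` as the only expanding point at all, by backward invariance; but `x` and `τ x` are both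
expanding. -/
theorem exists_ne_mem_expandingSet {x : X} (hx : x ∈ expandingSet g) {A : Set X} (hA : IsOpen A)
    (hxA : x ∈ A) : ∃ y ∈ A, y ≠ x ∧ y ∈ expandingSet g := by
  by_contra! hcon
  obtain ⟨n, hn⟩ := hx A hA hxA
  have key : ∀ y ∈ expandingSet g, y = g^[n] x := by
    intro y hy
    obtain ⟨u, hu, rfl⟩ : y ∈ g^[n] '' A := hn ▸ mem_univ y
    by_cases hux : u = x
    · rw [hux]
    · exact absurd (h.mem_expandingSet_of_iterate hy) (hcon u hu hux)
  have h1 := key x hx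
  have h2 := key (τ x) (h.mem_expandingSet_of_map (by
    rw [h.map_deck]; exact h.map_mem_expandingSet hx))
  exact h.deck_ne x (h2.trans h1.symm)

end Topological

/-! ### Uniform separation of fibres: the lower entropy bound and the failure of equicontinuity -/

section Uniform

variable {X : Type*} [UniformSpace X] [CompactSpace X] [T2Space X] {g τ : X → X}
  (h : IsDoubleCover g τ)

include h

/-- By compactness, a free involution moves all points by a uniform amount. -/
theorem setOf_ne_deck_mem_uniformity : {p : X × X | p.2 ≠ τ p.1} ∈ 𝓤 X := by
  rw [← nhdsSet_diagonal_eq_uniformity]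
  refine IsOpen.mem_nhdsSet ?_ |>.2 ?_
  · exact (isClosed_eq continuous_snd (h.continuous_deck.comp continuous_fst)).isOpen_compl
  · rintro ⟨x, y⟩ hxy
    obtain rfl : x = y := hxy
    exact (h.deck_ne x).symm

/-- Distinct points of a fibre of `g^[n]` are exchanged by `τ` at some time before `n`, so they
cannot both shadow a common orbit at scale `V`. Each such fibre, which has `2 ^ n` points, is
therefore a dynamical net. -/
theorem log_two_le_coverEntropy [Nonempty X] :
    ((Real.log 2 : ℝ) : EReal) ≤ Dynamics.coverEntropy g univ := by
  obtain ⟨V, hV, hsymm, hVV⟩ := comp_symm_mem_uniformity_sets h.setOf_ne_deck_mem_uniformity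
  refine le_trans ?_ (Dynamics.netEntropyEntourage_le_coverEntropy (T := g) (F := univ) hV)
  have hlog : ((Real.log 2 : ℝ) : EReal) = ENNReal.log 2 := by
    rw [show (2 : ENNReal) = ENNReal.ofReal 2 by simp, ENNReal.log_ofReal_of_pos (by norm_num)]
  rw [hlog, ← ExpGrowth.expGrowthSup_pow]
  refine ExpGrowth.expGrowthSup_monotone fun n => ?_
  obtain ⟨S, hS, hS'⟩ := h.exists_finset_iterate_eq n (Classical.arbitrary X)
  have hnet : Dynamics.IsDynNetIn g univ V n (S : Set X) := by
    refine ⟨subset_univ _, fun x hx y hy hxy => ?_⟩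
    refine disjoint_left.2 fun z hz hz' => hxy ?_
    refine h.eq_of_iterate_eq ((hS' x hx).trans (hS' y hy).symm) fun k hk => ?_
    exact hVV (SetRel.prodMk_mem_comp (Dynamics.mem_dynEntourage.1 hz k hk)
      (hsymm.symm _ _ (Dynamics.mem_dynEntourage.1 hz' k hk)))
  have := hnet.card_le_netMaxcard
  rw [hS] at this
  have h2 := ENat.toENNReal_mono this
  simpa using h2

/-- Equicontinuity everywhere would cover the space by finitely many sets on which all iterates are
`V`-close to those of a centre. With more than that many points in one fibre, two would share a
centre and never be separated. -/
theorem exists_not_equicontinuousAt [Nonempty X] :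
    ∃ x, ¬ EquicontinuousAt (fun n : ℕ => g^[n]) x := by
  by_contra! hcon
  obtain ⟨V, hV, hsymm, hVV⟩ := comp_symm_mem_uniformity_sets h.setOf_ne_deck_mem_uniformity
  obtain ⟨t, -, ht⟩ := isCompact_univ.elim_nhds_subcover _ (fun x _ => hcon x V hV)
  obtain ⟨S, hS, hS'⟩ := h.exists_finset_iterate_eq t.card (Classical.arbitrary X)
  have hcov : ∀ y : X, ∃ c ∈ t, ∀ n, (g^[n] c, g^[n] y) ∈ V := by
    intro y
    obtain ⟨c, hc, hy⟩ := mem_iUnion₂.1 (ht (mem_univ y))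
    exact ⟨c, hc, hy⟩
  choose c hct hc using hcov
  obtain ⟨x, hx, y, hy, hxy, hcxy⟩ := Finset.exists_ne_map_eq_of_card_lt_of_maps_to
    (hS ▸ Nat.lt_two_pow_self : t.card < S.card) (fun y _ => hct y)
  refine hxy (h.eq_of_iterate_eq ((hS' x hx).trans (hS' y hy).symm) fun k _ => ?_)
  exact hVV (SetRel.prodMk_mem_comp (hsymm.symm _ _ (hc x k)) (hcxy ▸ hc y k))

end Uniform

end IsDoubleCover

/-! ### Homogeneous coordinates on the projective line -/

section Proj

variable {K : Type*}

open Classical in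
/-- The point of the projective line with given homogeneous coordinates. -/
noncomputable def proj [Field K] (v : K × K) : OnePoint K :=
  if v.2 = 0 then OnePoint.infty else OnePoint.some (v.1 / v.2)

theorem proj_of_eq_zero [Field K] {v : K × K} (h : v.2 = 0) : proj v = OnePoint.infty := if_pos h

theorem proj_of_ne_zero [Field K] {v : K × K} (h : v.2 ≠ 0) :
    proj v = OnePoint.some (v.1 / v.2) := if_neg h

theorem fst_ne_zero_of_snd_eq_zero [Zero K] {v : K × K} (hv : v ≠ 0) (h : v.2 = 0) : v.1 ≠ 0 :=
  fun h1 => hv (Prod.ext h1 h)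

theorem proj_eq_iff [Field K] {u v : K × K} (hu : u ≠ 0) (hv : v ≠ 0) :
    proj u = proj v ↔ u.1 * v.2 = v.1 * u.2 := by
  by_cases h1 : u.2 = 0 <;> by_cases h2 : v.2 = 0
  · simp [proj_of_eq_zero, h1, h2]
  · simp [proj_of_eq_zero h1, proj_of_ne_zero h2, h1, h2, fst_ne_zero_of_snd_eq_zero hu h1]
  · simp [proj_of_ne_zero h1, proj_of_eq_zero h2, h1, h2, fst_ne_zero_of_snd_eq_zero hv h2]
  · rw [proj_of_ne_zero h1, proj_of_ne_zero h2, OnePoint.coe_eq_coe, div_eq_div_iff h1 h2]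

theorem proj_smul [Field K] {c : K} (hc : c ≠ 0) (v : K × K) : proj (c • v) = proj v := by
  by_cases h : v.2 = 0
  · rw [proj_of_eq_zero h, proj_of_eq_zero (by simp [h])]
  · rw [proj_of_ne_zero h, proj_of_ne_zero (by simp [h, hc])]
    simp [mul_div_mul_left _ _ hc]

theorem proj_mk_one [Field K] (t : K) : proj (t, 1) = OnePoint.some t := by
  rw [proj_of_ne_zero (by simp)]
  simp

theorem proj_one_zero [Field K] : proj ((1, 0) : K × K) = OnePoint.infty :=
  proj_of_eq_zero rfl

theorem exists_proj_eq [Field K] (x : OnePoint K) : ∃ v : K × K, v ≠ 0 ∧ proj v = x := by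
  induction x using OnePoint.rec with
  | infty => exact ⟨(1, 0), by simp, proj_one_zero⟩
  | coe t => exact ⟨(t, 1), by simp, proj_mk_one t⟩

variable [RCLike K]

theorem continuousAt_proj {v : K × K} (hv : v ≠ 0) : ContinuousAt (proj : K × K → OnePoint K) v := by
  by_cases h : v.2 = 0
  · rw [ContinuousAt, proj_of_eq_zero h]
    have hv1 := fst_ne_zero_of_snd_eq_zero hv h
    rw [OnePoint.hasBasis_nhds_infty.tendsto_right_iff]
    rintro s ⟨-, hs⟩
    obtain ⟨R, hR⟩ := hs.isBounded.exists_norm_le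
    have hev : ∀ᶠ w : K × K in 𝓝 v, R * ‖w.2‖ < ‖w.1‖ := by
      refine ContinuousAt.eventually_lt (by fun_prop) (by fun_prop) ?_
      simpa [h] using hv1
    filter_upwards [hev] with w hw
    by_cases hw2 : w.2 = 0
    · rw [proj_of_eq_zero hw2]
      exact Or.inr rfl
    · rw [proj_of_ne_zero hw2]
      refine Or.inl ⟨_, fun hmem => ?_, rfl⟩
      have := hR _ hmem
      rw [norm_div, div_le_iff₀ (norm_pos_iff.2 hw2)] at this
      exact absurd hw (not_lt.2 this)
  · have hev : proj =ᶠ[𝓝 v] fun w : K × K => ((w.1 / w.2 : K) : OnePoint K) := by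
      have : ∀ᶠ w : K × K in 𝓝 v, w.2 ≠ 0 := continuousAt_snd.eventually_ne h
      filter_upwards [this] with w hw
      exact proj_of_ne_zero hw
    refine ContinuousAt.congr ?_ hev.symm
    exact OnePoint.continuous_coe.continuousAt.comp
      (continuousAt_fst.div continuousAt_snd h)

/-- Restricted to the unit sphere, `proj` is a continuous surjection from a compact space to a
Hausdorff one, hence a quotient map. -/
theorem continuous_of_comp_proj {Y : Type*} [TopologicalSpace Y] {F : OnePoint K → Y}
    (hF : ∀ v : K × K, v ≠ 0 → ContinuousAt (fun w => F (proj w)) v) : Continuous F := by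
  have hne : ∀ v : Metric.sphere (0 : K × K) 1, (v : K × K) ≠ 0 := fun v hv => by
    have := v.2
    rw [hv] at this
    simp at this
  have hcont : Continuous fun v : Metric.sphere (0 : K × K) 1 => proj (v : K × K) :=
    continuous_iff_continuousAt.2 fun v =>
      ContinuousAt.comp (g := proj) (continuousAt_proj (hne v)) continuousAt_subtype_val
  have hsurj : Function.Surjective fun v : Metric.sphere (0 : K × K) 1 => proj (v : K × K) := by
    intro x
    obtain ⟨v, hv, rfl⟩ := exists_proj_eq x
    have hn : ‖v‖ ≠ 0 := norm_ne_zero_iff.2 hv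
    have hc : ((‖v‖⁻¹ : ℝ) : K) ≠ 0 := by
      simpa using hn
    refine ⟨⟨((‖v‖⁻¹ : ℝ) : K) • v, ?_⟩, proj_smul hc v⟩
    rw [mem_sphere_zero_iff_norm, norm_smul, RCLike.norm_ofReal, abs_inv, abs_norm,
      inv_mul_cancel₀ hn]
  refine ((hcont.isClosedMap.isQuotientMap hcont hsurj).continuous_iff).2 ?_
  exact continuous_iff_continuousAt.2 fun v =>
    ContinuousAt.comp (g := fun w => F (proj w)) (hF v (hne v)) continuousAt_subtype_val

theorem continuous_of_semiconj_proj {g : OnePoint K → OnePoint K} {F : K × K → K × K}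
    (hF : Continuous F) (hne : ∀ v, v ≠ 0 → F v ≠ 0) (h : ∀ v, v ≠ 0 → g (proj v) = proj (F v)) :
    Continuous g := by
  refine continuous_of_comp_proj fun v hv => ?_
  have hev : (fun w => g (proj w)) =ᶠ[𝓝 v] fun w => proj (F w) := by
    filter_upwards [isOpen_ne.mem_nhds hv] with w hw
    exact h w hw
  exact ContinuousAt.congr (ContinuousAt.comp (g := proj) (continuousAt_proj (hne v hv))
    hF.continuousAt) hev.symm

/-- The local parametrisation, in homogeneous coordinates and with real coefficients, of the
projective line around the point `x` of the real circle. -/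
def chart (K : Type*) [RCLike K] (x : OnePoint ℝ) (t : K) : K × K :=
  x.elim (1, t) (fun r => ((r : K) + t, 1))

theorem chart_ne_zero (x : OnePoint ℝ) (t : K) : chart K x t ≠ 0 := by
  induction x using OnePoint.rec with
  | infty => exact fun h => one_ne_zero (congrArg Prod.fst h)
  | coe r => exact fun h => one_ne_zero (congrArg Prod.snd h)

theorem proj_chart_zero (x : OnePoint ℝ) : proj (chart ℝ x 0) = x := by
  induction x using OnePoint.rec with
  | infty => exact proj_one_zero
  | coe r =>
    simp only [chart, OnePoint.elim_some, add_zero]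
    exact proj_mk_one r

open Classical in
/-- The inversion `z ↦ 1 / z` of the projective line. -/
noncomputable def inversion (x : OnePoint K) : OnePoint K :=
  x.elim (OnePoint.some 0) (fun t => if t = 0 then OnePoint.infty else OnePoint.some t⁻¹)

theorem inversion_proj {v : K × K} (hv : v ≠ 0) : inversion (proj v) = proj v.swap := by
  by_cases h : v.2 = 0
  · rw [proj_of_eq_zero h, proj_of_ne_zero (by exact fst_ne_zero_of_snd_eq_zero hv h)]
    simp [inversion, h]
  · rw [proj_of_ne_zero h]
    by_cases h1 : v.1 = 0
    · rw [proj_of_eq_zero (by exact h1)]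
      simp [inversion, h1]
    · rw [proj_of_ne_zero (by exact h1)]
      simp [inversion, h1, h]

theorem swap_ne_zero {v : K × K} (hv : v ≠ 0) : v.swap ≠ 0 := fun h =>
  hv (Prod.ext (congrArg Prod.snd h) (congrArg Prod.fst h))

theorem inversion_inversion (x : OnePoint K) : inversion (inversion x) = x := by
  obtain ⟨v, hv, rfl⟩ := exists_proj_eq x
  rw [inversion_proj hv, inversion_proj (swap_ne_zero hv), Prod.swap_swap]

theorem continuous_inversion : Continuous (inversion : OnePoint K → OnePoint K) :=
  continuous_of_semiconj_proj continuous_swap (fun _ => swap_ne_zero) (fun _ => inversion_proj)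

theorem isOpenEmbedding_proj_chart (x : OnePoint ℝ) :
    IsOpenEmbedding fun t : K => proj (chart K x t) := by
  induction x using OnePoint.rec with
  | infty =>
    have : (fun t : K => proj (chart K OnePoint.infty t)) = inversion ∘ OnePoint.some := by
      funext t
      rw [Function.comp, ← proj_mk_one, inversion_proj (by simp)]
      rfl
    rw [this]
    let e : OnePoint K ≃ₜ OnePoint K :=
      { toFun := inversion
        invFun := inversion
        left_inv := inversion_inversion
        right_inv := inversion_inversion
        continuous_toFun := continuous_inversion
        continuous_invFun := continuous_inversion }
    exact e.isOpenEmbedding.comp OnePoint.isOpenEmbedding_coe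
  | coe r =>
    have : (fun t : K => proj (chart K (OnePoint.some r) t)) =
        OnePoint.some ∘ Homeomorph.addLeft (r : K) := by
      funext t
      exact proj_mk_one _
    rw [this]
    exact OnePoint.isOpenEmbedding_coe.comp (Homeomorph.isOpenEmbedding _)

theorem continuous_chart (x : OnePoint ℝ) : Continuous (chart K x) := by
  induction x using OnePoint.rec with
  | infty => exact continuous_const.prodMk continuous_id
  | coe r => exact (continuous_const.add continuous_id).prodMk continuous_const

end Proj

/-! ### The real circle -/

theorem hasBasis_nhds_circle (x : OnePoint ℝ) :
    (𝓝 x).HasBasis (fun r : ℝ => 0 < r) fun r => (fun t => proj (chart ℝ x t)) '' Metric.ball 0 r := by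
  have h := (isOpenEmbedding_proj_chart (K := ℝ) x).map_nhds_eq 0
  simp only [proj_chart_zero] at h
  rw [← h]
  exact Metric.nhds_basis_ball.map _

/-- Used in the entropy bound, where components of an open set have to be open. -/
instance : LocallyConnectedSpace (OnePoint ℝ) :=
  locallyConnectedSpace_of_connected_bases _ _ hasBasis_nhds_circle fun x r _ =>
    ((convex_ball (0 : ℝ) r).isPreconnected).image _
      (isOpenEmbedding_proj_chart x).continuous.continuousOn

theorem frontier_arc_subset (x : OnePoint ℝ) (a b : ℝ) :
    frontier ((fun t => proj (chart ℝ x t)) '' Icc a b) ⊆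
      (fun t => proj (chart ℝ x t)) '' {a, b} := by
  have he := isOpenEmbedding_proj_chart (K := ℝ) x
  rw [(isCompact_Icc.image he.continuous).isClosed.frontier_eq]
  rintro _ ⟨⟨t, ht, rfl⟩, hint⟩
  refine ⟨t, ?_, rfl⟩
  by_contra hne
  refine hint (interior_maximal (image_mono Ioo_subset_Icc_self)
    (he.isOpenMap _ isOpen_Ioo) ⟨t, ?_, rfl⟩)
  simp only [mem_insert_iff, mem_singleton_iff, not_or] at hne
  exact ⟨lt_of_le_of_ne ht.1 (Ne.symm hne.1), lt_of_le_of_ne ht.2 hne.2⟩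

theorem subset_interior_of_disjoint_frontier {X : Type*} [TopologicalSpace X] {C N : Set X}
    (hC : IsPreconnected C) (hfr : ∀ u ∈ C, u ∉ frontier N) (hne : (C ∩ N).Nonempty) :
    C ⊆ interior N := by
  obtain ⟨y, hy, hyN⟩ := hne
  refine hC.subset_left_of_subset_union isOpen_interior isClosed_closure.isOpen_compl
    (disjoint_compl_right.mono_left (interior_subset.trans subset_closure)) (fun u hu => ?_)
    ⟨y, hy, ?_⟩
  · by_contra hcon
    rw [mem_union, not_or, notMem_compl_iff] at hcon
    exact hfr u hu ⟨hcon.2, hcon.1⟩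
  · by_contra hcon
    exact hfr y hy ⟨subset_closure hyN, hcon⟩

/-- The circle is covered by finitely many `V`-small arcs, and `E` contains their end points. A
connected set which meets an arc and misses its end points stays in it. -/
theorem exists_finset_separating (V : Set (OnePoint ℝ × OnePoint ℝ))
    (hV : ∀ x, ∃ N ∈ 𝓝 x, ∀ y ∈ N, ∀ z ∈ N, (y, z) ∈ V) :
    ∃ E : Finset (OnePoint ℝ), E.Nonempty ∧ ∀ C : Set (OnePoint ℝ), IsPreconnected C →
      (∀ x ∈ C, x ∉ E) → ∀ y ∈ C, ∀ z ∈ C, (y, z) ∈ V := by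
  classical
  have key : ∀ x : OnePoint ℝ, ∃ N ∈ 𝓝 x, (frontier N).Finite ∧ ∀ y ∈ N, ∀ z ∈ N, (y, z) ∈ V := by
    intro x
    obtain ⟨N, hN, hNV⟩ := hV x
    obtain ⟨r, hr, hrN⟩ := (hasBasis_nhds_circle x).mem_iff.1 hN
    have he := isOpenEmbedding_proj_chart (K := ℝ) x
    set ψ := fun t : ℝ => proj (chart ℝ x t) with hψ
    have hsub : ψ '' Icc (-(r / 2)) (r / 2) ⊆ N := by
      refine (image_mono fun t ht => ?_).trans hrN
      rw [mem_ball_zero_iff, Real.norm_eq_abs]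
      exact (abs_le.2 ht).trans_lt (by linarith)
    refine ⟨ψ '' Icc (-(r / 2)) (r / 2), ?_, ?_, fun y hy z hz => hNV y (hsub hy) z (hsub hz)⟩
    · refine mem_of_superset ((hasBasis_nhds_circle x).mem_of_mem (half_pos hr))
        (image_mono fun t ht => ?_)
      rw [mem_ball_zero_iff, Real.norm_eq_abs] at ht
      exact abs_le.1 ht.le
    · exact (Set.toFinite _).subset (frontier_arc_subset x _ _)
  choose N hN hfin hNV using key
  obtain ⟨t, -, ht⟩ := isCompact_univ.elim_nhds_subcover N (fun x _ => hN x)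
  -- The point `∞` is added only to make the set nonempty.
  refine ⟨insert OnePoint.infty (t.biUnion fun x => (hfin x).toFinset), Finset.insert_nonempty _ _,
    fun C hC hCE y hy z hz => ?_⟩
  obtain ⟨c, hc, hyc⟩ := mem_iUnion₂.1 (ht (mem_univ y))
  have hfr : ∀ u ∈ C, u ∉ frontier (N c) := fun u hu hfr =>
    hCE u hu (Finset.mem_insert_of_mem (Finset.mem_biUnion.2 ⟨c, hc, (hfin c).mem_toFinset.2 hfr⟩))
  have hCN := subset_interior_of_disjoint_frontier hC hfr ⟨y, hy, hyc⟩
  exact hNV c y hyc z (interior_subset (hCN hz))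

/-! ### Upper bound for the entropy of a double cover of the circle -/

namespace IsDoubleCover

theorem exists_finset_preimage {X : Type*} [TopologicalSpace X] {g τ : X → X}
    (h : IsDoubleCover g τ) (S : Finset X) :
    ∃ T : Finset X, T.card ≤ 2 * S.card ∧ ∀ x, g x ∈ S → x ∈ T := by
  classical
  choose q hq using h.surjective
  refine ⟨S.image q ∪ S.image (τ ∘ q), ?_, fun x hx => ?_⟩
  · refine (Finset.card_union_le _ _).trans ?_
    rw [two_mul]
    exact add_le_add Finset.card_image_le Finset.card_image_le
  · rcases (h.map_eq_iff (q (g x)) x).1 (hq _) with h1 | h1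
    · exact Finset.mem_union_left _ (Finset.mem_image.2 ⟨g x, hx, h1.symm⟩)
    · exact Finset.mem_union_right _ (Finset.mem_image.2 ⟨g x, hx, h1.symm⟩)

/-- Pulling back at most doubles the number of points, so the preimages up to time `n` are counted
by the sum `1 + 2 + ⋯ + 2 ^ n`. -/
theorem exists_finset_iterate {X : Type*} [TopologicalSpace X] {g τ : X → X}
    (h : IsDoubleCover g τ) (E : Finset X) (n : ℕ) :
    ∃ T : Finset X, T.card ≤ E.card * (2 ^ (n + 1) - 1) ∧ E ⊆ T ∧
      ∀ k ≤ n, ∀ x, g^[k] x ∈ E → x ∈ T := by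
  classical
  induction n with
  | zero => exact ⟨E, by simp, subset_rfl, fun k hk x hx => by simpa [Nat.le_zero.1 hk] using hx⟩
  | succ n ih =>
    obtain ⟨T, hT, hET, hT'⟩ := ih
    obtain ⟨T', hcard, hT''⟩ := h.exists_finset_preimage T
    refine ⟨E ∪ T', ?_, Finset.subset_union_left, fun k hk x hx => ?_⟩
    · refine (Finset.card_union_le _ _).trans ?_
      have h1 : 1 ≤ 2 ^ (n + 1) := Nat.one_le_two_pow
      obtain ⟨a, ha⟩ := Nat.exists_eq_add_of_le h1
      have h2 : 2 ^ (n + 1 + 1) - 1 = 1 + 2 * a := by rw [pow_succ, ha]; omega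
      rw [h2]
      have h3 : 2 ^ (n + 1) - 1 = a := by omega
      rw [h3] at hT
      nlinarith
    · cases k with
      | zero => exact Finset.mem_union_left _ hx
      | succ k =>
        refine Finset.mem_union_right _ (hT'' x (hT' k (by omega) (g x) ?_))
        rwa [← Function.iterate_succ_apply]

/-- Topological entropy of a double cover of the circle is at most `log 2`. -/
theorem topEntropy_le_log_two {g τ : OnePoint ℝ → OnePoint ℝ} (h : IsDoubleCover g τ) :
    topEntropy g ≤ ((Real.log 2 : ℝ) : EReal) := by
  let _ : UniformSpace (OnePoint ℝ) := uniformSpaceOfCompactR1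
  change Dynamics.coverEntropy g univ ≤ _
  have hlog : ((Real.log 2 : ℝ) : EReal) = ENNReal.log 2 := by
    rw [show (2 : ENNReal) = ENNReal.ofReal 2 by simp, ENNReal.log_ofReal_of_pos (by norm_num)]
  rw [hlog, ← ExpGrowth.expGrowthSup_pow]
  refine iSup₂_le fun U hU => ?_
  -- `V` is taken closed so that smallness passes from a component to its closure, which is where
  -- the points of `T` lie.
  obtain ⟨V, ⟨hV, hVcl⟩, hVU⟩ := uniformity_hasBasis_closed.mem_iff.1 hU
  obtain ⟨E, hE, hEV⟩ := exists_finset_separating V fun x => by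
    obtain ⟨W, hW, hsymm, hWV⟩ := comp_symm_mem_uniformity_sets hV
    refine ⟨ball x W, ball_mem_nhds x hW, fun y hy z hz => hWV ?_⟩
    exact SetRel.prodMk_mem_comp (hsymm.symm _ _ hy) hz
  -- A constant factor, here twice the size of `E`, does not affect exponential growth.
  refine ExpGrowth.expGrowthSup_le_of_eventually_le (b := (2 * E.card : ℕ))
    (ENNReal.natCast_ne_top _) (Eventually.of_forall fun n => ?_)
  obtain ⟨T, hTcard, hET, hT⟩ := h.exists_finset_iterate E n
  have hcover : Dynamics.IsDynCoverOf g univ U n (T : Set (OnePoint ℝ)) := by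
    intro x _
    by_cases hx : x ∈ T
    · refine ⟨x, hx, Dynamics.mem_dynEntourage.2 fun k _ => refl_mem_uniformity hU⟩
    · have hopen : IsOpen ((T : Set (OnePoint ℝ))ᶜ) := T.finite_toSet.isClosed.isOpen_compl
      set C := connectedComponentIn ((T : Set (OnePoint ℝ))ᶜ) x with hCdef
      have hxC : x ∈ C := mem_connectedComponentIn hx
      have hCpre : IsPreconnected C := isPreconnected_connectedComponentIn
      have hCT : C ⊆ (T : Set (OnePoint ℝ))ᶜ := connectedComponentIn_subset _ _
      -- A component with no point of `T` in its closure would be clopen, hence the whole circle,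
      -- although `T` is nonempty.
      have hex : ∃ e ∈ T, e ∈ closure C := by
        by_contra! hcon
        have h1 : closure C ⊆ C := hCpre.closure.subset_connectedComponentIn
          (subset_closure hxC) fun y hy hyT => hcon y hyT hy
        have h2 : IsClopen C := ⟨isClosed_of_closure_subset h1, hopen.connectedComponentIn⟩
        have h3 := h2.eq_univ ⟨x, hxC⟩
        obtain ⟨e, he⟩ := hE
        exact hCT (h3 ▸ mem_univ e) (hET he)
      obtain ⟨e, heT, heC⟩ := hex
      refine ⟨e, heT, Dynamics.mem_dynEntourage.2 fun k hk => hVU ?_⟩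
      have hcont := h.continuous_map.iterate k
      have hsmall := hEV (g^[k] '' C) (hCpre.image _ hcont.continuousOn) (by
        rintro _ ⟨y, hy, rfl⟩ hyE
        exact hCT hy (hT k hk.le y hyE))
      have hsub : closure (C ×ˢ C) ⊆ (fun p : OnePoint ℝ × OnePoint ℝ =>
          (g^[k] p.1, g^[k] p.2)) ⁻¹' V := by
        refine closure_minimal ?_ (hVcl.preimage (by fun_prop))
        rintro ⟨y, z⟩ ⟨hy, hz⟩
        exact hsmall _ ⟨y, hy, rfl⟩ _ ⟨z, hz, rfl⟩
      rw [closure_prod_eq] at hsub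
      exact hsub (mk_mem_prod (subset_closure hxC) heC)
  have h1 := hcover.coverMincard_le_card
  have h2 : T.card ≤ 2 * E.card * 2 ^ n := by
    refine hTcard.trans ((Nat.mul_le_mul_left _ (Nat.sub_le _ _)).trans_eq ?_)
    ring
  have h3 := ENat.toENNReal_mono (h1.trans (Nat.cast_le.2 h2))
  simpa using h3

theorem topEntropy_eq_log_two {g τ : OnePoint ℝ → OnePoint ℝ} (h : IsDoubleCover g τ) :
    topEntropy g = ((Real.log 2 : ℝ) : EReal) := by
  refine le_antisymm h.topEntropy_le_log_two ?_
  let _ : UniformSpace (OnePoint ℝ) := uniformSpaceOfCompactR1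
  exact h.log_two_le_coverEntropy

end IsDoubleCover

/-! ### Pairs of binary quadratic forms -/

/-- A pair of real binary quadratic forms `p₂ a² + p₁ a b + p₀ b²`, `q₂ a² + q₁ a b + q₀ b²`. -/
structure QuadPair where
  (p₂ p₁ p₀ q₂ q₁ q₀ : ℝ)

namespace QuadPair

variable (Φ : QuadPair) (K : Type*) [RCLike K]

/-- The map `K² → K²` with the two forms as components. -/
def lift (v : K × K) : K × K :=
  ((Φ.p₂ : K) * v.1 ^ 2 + Φ.p₁ * v.1 * v.2 + Φ.p₀ * v.2 ^ 2,
    (Φ.q₂ : K) * v.1 ^ 2 + Φ.q₁ * v.1 * v.2 + Φ.q₀ * v.2 ^ 2)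

/-- The leading coefficient of the critical form. -/
def lead : ℝ := Φ.p₂ * Φ.q₁ - Φ.p₁ * Φ.q₂

/-- Half of the middle coefficient of the critical form. -/
def mid : ℝ := Φ.p₂ * Φ.q₀ - Φ.p₀ * Φ.q₂

/-- The last coefficient of the critical form. -/
def tail : ℝ := Φ.p₁ * Φ.q₀ - Φ.p₀ * Φ.q₁

/-- The resultant of the two forms. -/
def res : ℝ := Φ.mid ^ 2 - Φ.lead * Φ.tail

/-- The critical form: half of the Jacobian determinant of `lift`. -/
def critForm (v : K × K) : K := Φ.lead * v.1 ^ 2 + 2 * Φ.mid * v.1 * v.2 + Φ.tail * v.2 ^ 2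

/-- The linear map which induces the deck involution. -/
def deckLift (v : K × K) : K × K :=
  (-(Φ.mid * v.1 + Φ.tail * v.2), Φ.lead * v.1 + Φ.mid * v.2)

variable {K}

theorem continuous_lift : Continuous (Φ.lift K) := by
  unfold lift
  fun_prop

theorem continuous_deckLift : Continuous (Φ.deckLift K) := by
  unfold deckLift
  fun_prop

/-- The left side vanishes for proportional `u` and `v`, hence is divisible by their determinant.
The quotient is the determinant of `v` and `deckLift u`, which is the polar form of `critForm`; its
zeros describe the nontrivial coincidences of values. -/
theorem lift_cross (u v : K × K) :
    (Φ.lift K u).1 * (Φ.lift K v).2 - (Φ.lift K v).1 * (Φ.lift K u).2 =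
      (u.1 * v.2 - v.1 * u.2) *
        (v.2 * -(Φ.deckLift K u).1 + v.1 * (Φ.deckLift K u).2) := by
  simp only [lift, deckLift, lead, mid, tail]
  push_cast
  ring

theorem deckLift_deckLift (v : K × K) : Φ.deckLift K (Φ.deckLift K v) = (Φ.res : K) • v := by
  ext <;> simp only [deckLift, res, Prod.smul_fst, Prod.smul_snd, smul_eq_mul] <;> push_cast <;> ring

theorem deckLift_smul (c : K) (v : K × K) : Φ.deckLift K (c • v) = c • Φ.deckLift K v := by
  ext <;> simp only [deckLift, Prod.smul_fst, Prod.smul_snd, smul_eq_mul] <;> ring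

theorem cross_deckLift (v : K × K) :
    v.1 * (Φ.deckLift K v).2 - (Φ.deckLift K v).1 * v.2 = Φ.critForm K v := by
  simp only [deckLift, critForm]
  ring

theorem lift_smul (c : K) (v : K × K) : Φ.lift K (c • v) = c ^ 2 • Φ.lift K v := by
  ext <;> simp only [lift, Prod.smul_fst, Prod.smul_snd, smul_eq_mul] <;> ring

theorem critForm_smul (c : K) (v : K × K) : Φ.critForm K (c • v) = c ^ 2 * Φ.critForm K v := by
  simp only [critForm, Prod.smul_fst, Prod.smul_snd, smul_eq_mul]
  ring

variable {Φ}

theorem deckLift_ne_zero (h : Φ.res ≠ 0) {v : K × K} (hv : v ≠ 0) : Φ.deckLift K v ≠ 0 := by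
  intro h0
  have h1 := Φ.deckLift_deckLift v
  rw [h0] at h1
  have h2 : Φ.deckLift K 0 = 0 := by simp [deckLift]
  rw [h2] at h1
  rcases smul_eq_zero.1 h1.symm with h3 | h3
  · exact h (by exact_mod_cast h3)
  · exact hv h3

theorem lead_ne_zero (h : Φ.res < 0) : Φ.lead ≠ 0 := by
  intro h0
  simp only [res, h0] at h
  nlinarith [sq_nonneg Φ.mid]

theorem critForm_ne_zero (h : Φ.res < 0) {v : ℝ × ℝ} (hv : v ≠ 0) : Φ.critForm ℝ v ≠ 0 := by
  intro h0
  have h1 : Φ.lead * Φ.critForm ℝ v = (Φ.lead * v.1 + Φ.mid * v.2) ^ 2 - Φ.res * v.2 ^ 2 := by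
    simp only [critForm, res, RCLike.ofReal_real_eq_id, id]
    ring
  rw [h0, mul_zero] at h1
  have h2 : v.2 = 0 := by
    by_contra hne
    nlinarith [sq_nonneg (Φ.lead * v.1 + Φ.mid * v.2), sq_pos_of_ne_zero hne]
  rw [h2] at h1
  have h3 : Φ.lead * v.1 = 0 := by nlinarith
  exact (mul_ne_zero (lead_ne_zero h) (fst_ne_zero_of_snd_eq_zero hv h2)) h3

theorem exists_critForm_eq_zero (h : 0 < Φ.res) : ∃ v : ℝ × ℝ, v ≠ 0 ∧ Φ.critForm ℝ v = 0 := by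
  by_cases hl : Φ.lead = 0
  · exact ⟨(1, 0), by simp, by simp [critForm, hl]⟩
  · refine ⟨(-Φ.mid + √Φ.res, Φ.lead), fun h0 => hl (congrArg Prod.snd h0), ?_⟩
    have h1 := Real.sq_sqrt h.le
    have h2 : Φ.res = Φ.mid ^ 2 - Φ.lead * Φ.tail := rfl
    simp only [critForm, RCLike.ofReal_real_eq_id, id]
    linear_combination Φ.lead * h1 + Φ.lead * h2

/-- The discriminant of the form `t P - s Q`. -/
def disc (Φ : QuadPair) (s t : ℝ) : ℝ :=
  (t * Φ.p₁ - s * Φ.q₁) ^ 2 - 4 * (t * Φ.p₂ - s * Φ.q₂) * (t * Φ.p₀ - s * Φ.q₀)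

/-- Completion of the square: as a quadratic form in `(s, t)`, `disc` has discriminant `16 * res`.
-/
theorem disc_identity (Φ : QuadPair) (s t : ℝ) :
    4 * (Φ.q₁ ^ 2 - 4 * Φ.q₂ * Φ.q₀) * Φ.disc s t =
      (2 * (Φ.q₁ ^ 2 - 4 * Φ.q₂ * Φ.q₀) * s +
        (-2 * Φ.p₁ * Φ.q₁ + 4 * (Φ.p₂ * Φ.q₀ + Φ.p₀ * Φ.q₂)) * t) ^ 2 - 16 * Φ.res * t ^ 2 := by
  simp only [disc, res, lead, mid, tail]
  ring

theorem disc_nonneg (h : Φ.res < 0) (s t : ℝ) : 0 ≤ Φ.disc s t := by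
  -- The definite form `disc` has its sign read off at the value of the map at `∞`: this value has a
  -- real preimage, so the discriminant there is a square.
  have h1 : Φ.disc Φ.p₂ Φ.q₂ = Φ.lead ^ 2 := by
    simp only [disc, lead]
    ring
  have h2 := Φ.disc_identity Φ.p₂ Φ.q₂
  rw [h1] at h2
  have h3 := sq_pos_of_ne_zero (lead_ne_zero h)
  have h4 : 0 ≤ Φ.q₁ ^ 2 - 4 * Φ.q₂ * Φ.q₀ := by
    by_contra! hneg
    have h5 : 4 * (Φ.q₁ ^ 2 - 4 * Φ.q₂ * Φ.q₀) * Φ.lead ^ 2 < 0 :=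
      mul_neg_of_neg_of_pos (by linarith) h3
    rw [h2] at h5
    nlinarith [sq_nonneg (2 * (Φ.q₁ ^ 2 - 4 * Φ.q₂ * Φ.q₀) * Φ.p₂ +
        (-2 * Φ.p₁ * Φ.q₁ + 4 * (Φ.p₂ * Φ.q₀ + Φ.p₀ * Φ.q₂)) * Φ.q₂), sq_nonneg Φ.q₂]
  have h5 : Φ.q₁ ^ 2 - 4 * Φ.q₂ * Φ.q₀ ≠ 0 := by
    intro h0
    have h6 := Φ.disc_identity 0 1
    rw [h0] at h6
    nlinarith [sq_nonneg (-2 * Φ.p₁ * Φ.q₁ + 4 * (Φ.p₂ * Φ.q₀ + Φ.p₀ * Φ.q₂))]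
  have h6 : 0 < Φ.q₁ ^ 2 - 4 * Φ.q₂ * Φ.q₀ := lt_of_le_of_ne h4 h5.symm
  have h7 := Φ.disc_identity s t
  by_contra! hneg
  have h8 : 4 * (Φ.q₁ ^ 2 - 4 * Φ.q₂ * Φ.q₀) * Φ.disc s t < 0 :=
    mul_neg_of_pos_of_neg (by linarith) hneg
  rw [h7] at h8
  nlinarith [sq_nonneg (2 * (Φ.q₁ ^ 2 - 4 * Φ.q₂ * Φ.q₀) * s +
        (-2 * Φ.p₁ * Φ.q₁ + 4 * (Φ.p₂ * Φ.q₀ + Φ.p₀ * Φ.q₂)) * t), sq_nonneg t]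

theorem exists_disc_neg (h : 0 < Φ.res) : ∃ s t : ℝ, (s, t) ≠ (0 : ℝ × ℝ) ∧ Φ.disc s t < 0 := by
  set e₂ := Φ.q₁ ^ 2 - 4 * Φ.q₂ * Φ.q₀ with he₂
  set e₁ := -2 * Φ.p₁ * Φ.q₁ + 4 * (Φ.p₂ * Φ.q₀ + Φ.p₀ * Φ.q₂) with he₁
  set e₀ := Φ.p₁ ^ 2 - 4 * Φ.p₂ * Φ.p₀ with he₀
  have hd : ∀ s t, Φ.disc s t = e₂ * s ^ 2 + e₁ * s * t + e₀ * t ^ 2 := fun s t => by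
    simp only [disc, he₂, he₁, he₀]
    ring
  have hr : e₁ ^ 2 - 4 * e₂ * e₀ = 16 * Φ.res := by
    simp only [he₂, he₁, he₀, res, lead, mid, tail]
    ring
  rcases lt_trichotomy e₂ 0 with h1 | h1 | h1
  · exact ⟨1, 0, by simp, by rw [hd]; simpa using h1⟩
  · have h2 : e₁ ≠ 0 := by
      intro h0
      rw [h1, h0] at hr
      linarith
    refine ⟨-(e₀ + 1) / e₁, 1, by simp, ?_⟩
    have h3 : e₁ * (-(e₀ + 1) / e₁) = -(e₀ + 1) := mul_div_cancel₀ _ h2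
    rw [hd, h1, h3]
    linarith
  -- The vertex of the parabola `s ↦ disc s t`, cleared of denominators.
  · refine ⟨-e₁, 2 * e₂, fun h0 => ?_, ?_⟩
    · have := congrArg Prod.snd h0
      simp at this
      linarith
    · rw [hd]
      have : e₂ * (-e₁) ^ 2 + e₁ * -e₁ * (2 * e₂) + e₀ * (2 * e₂) ^ 2 =
        -(e₂ * (e₁ ^ 2 - 4 * e₂ * e₀)) := by ring
      rw [this, hr]
      have := mul_pos h1 h
      linarith

theorem exists_lift_cross_eq_zero (h : Φ.res < 0) (w : ℝ × ℝ) :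
    ∃ v : ℝ × ℝ, v ≠ 0 ∧ (Φ.lift ℝ v).1 * w.2 = w.1 * (Φ.lift ℝ v).2 := by
  have hD := Real.sq_sqrt (disc_nonneg h w.1 w.2)
  by_cases hα : w.2 * Φ.p₂ - w.1 * Φ.q₂ = 0
  · refine ⟨(1, 0), by simp, ?_⟩
    simp only [lift, RCLike.ofReal_real_eq_id, id]
    linear_combination hα
  · refine ⟨(-(w.2 * Φ.p₁ - w.1 * Φ.q₁) + √(Φ.disc w.1 w.2), 2 * (w.2 * Φ.p₂ - w.1 * Φ.q₂)),
      fun h0 => hα ?_, ?_⟩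
    · have := congrArg Prod.snd h0
      simpa using this
    · have hd : Φ.disc w.1 w.2 = (w.2 * Φ.p₁ - w.1 * Φ.q₁) ^ 2 -
        4 * (w.2 * Φ.p₂ - w.1 * Φ.q₂) * (w.2 * Φ.p₀ - w.1 * Φ.q₀) := rfl
      simp only [lift, RCLike.ofReal_real_eq_id, id]
      linear_combination (w.2 * Φ.p₂ - w.1 * Φ.q₂) * hD + (w.2 * Φ.p₂ - w.1 * Φ.q₂) * hd

theorem lift_cross_ne_zero {s t : ℝ} (h : Φ.disc s t < 0) {v : ℝ × ℝ} (hv : v ≠ 0) :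
    (Φ.lift ℝ v).1 * t ≠ s * (Φ.lift ℝ v).2 := by
  intro h0
  have h1 : (2 * (t * Φ.p₂ - s * Φ.q₂) * v.1 + (t * Φ.p₁ - s * Φ.q₁) * v.2) ^ 2 =
      Φ.disc s t * v.2 ^ 2 := by
    simp only [lift, RCLike.ofReal_real_eq_id, id] at h0
    simp only [disc]
    linear_combination 4 * (t * Φ.p₂ - s * Φ.q₂) * h0
  have h2 : v.2 = 0 := by
    by_contra hne
    nlinarith [sq_nonneg (2 * (t * Φ.p₂ - s * Φ.q₂) * v.1 + (t * Φ.p₁ - s * Φ.q₁) * v.2),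
      sq_pos_of_ne_zero hne]
  rw [h2] at h1
  have h3 : (t * Φ.p₂ - s * Φ.q₂) * v.1 = 0 := by nlinarith
  have h4 : t * Φ.p₂ - s * Φ.q₂ = 0 :=
    (mul_eq_zero.1 h3).resolve_right (fst_ne_zero_of_snd_eq_zero hv h2)
  simp only [disc, h4] at h
  nlinarith [sq_nonneg (t * Φ.p₁ - s * Φ.q₁)]

/-- The Hermitian form by which the imaginary part of `v₁ / v₂`, suitably normalised, is multiplied
under the map. -/
def hermForm (Φ : QuadPair) (v : ℂ × ℂ) : ℝ :=
  Φ.lead * Complex.normSq v.1 + 2 * Φ.mid * (v.1 * star v.2).re + Φ.tail * Complex.normSq v.2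

/-- This is `lift_cross` for `v` and its conjugate: the forms are real, and the determinant of a
vector and its conjugate is `2i` times the imaginary part. -/
theorem im_lift (Φ : QuadPair) (v : ℂ × ℂ) :
    ((Φ.lift ℂ v).1 * star (Φ.lift ℂ v).2).im = (v.1 * star v.2).im * Φ.hermForm v := by
  obtain ⟨⟨a, b⟩, ⟨c, d⟩⟩ := v
  simp only [lift, hermForm, lead, mid, tail, Complex.normSq_mk, pow_two, RCLike.star_def, map_add,
    map_mul, Complex.conj_ofReal, Complex.coe_algebraMap, Complex.mul_im, Complex.add_im,
    Complex.mul_re, Complex.add_re, Complex.ofReal_re, Complex.ofReal_im, Complex.conj_re,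
    Complex.conj_im]
  ring

theorem lead_mul_hermForm_pos (h : Φ.res < 0) {v : ℂ × ℂ} (hv : v ≠ 0) :
    0 < Φ.lead * Φ.hermForm v := by
  have h1 : Φ.lead * Φ.hermForm v =
      Complex.normSq (Φ.lead * v.1 + Φ.mid * v.2) - Φ.res * Complex.normSq v.2 := by
    obtain ⟨⟨a, b⟩, ⟨c, d⟩⟩ := v
    simp only [hermForm, res, Complex.normSq_apply, RCLike.star_def, Complex.mul_im, Complex.add_im,
      Complex.mul_re, Complex.add_re, Complex.ofReal_re, Complex.ofReal_im, Complex.conj_re,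
      Complex.conj_im]
    ring
  rw [h1]
  by_cases h2 : v.2 = 0
  · have h3 : (Φ.lead : ℂ) * v.1 ≠ 0 := mul_ne_zero (by exact_mod_cast lead_ne_zero h)
      (fst_ne_zero_of_snd_eq_zero hv h2)
    rw [h2]
    simpa only [mul_zero, add_zero, map_zero, sub_zero] using Complex.normSq_pos.2 h3
  · have h3 := Complex.normSq_pos.2 h2
    have h4 := Complex.normSq_nonneg (Φ.lead * v.1 + Φ.mid * v.2)
    nlinarith

end QuadPair

/-! ### The quadratic forms of a rational function of degree two -/

section Coefficients

variable (f : RatFunc ℝ)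

/-- The numerator and the denominator of `f`, made homogeneous of degree two. -/
noncomputable def quadPair : QuadPair where
  p₂ := f.num.coeff 2
  p₁ := f.num.coeff 1
  p₀ := f.num.coeff 0
  q₂ := f.denom.coeff 2
  q₁ := f.denom.coeff 1
  q₀ := f.denom.coeff 0

variable {f} {K : Type*} [RCLike K]

theorem aeval_of_natDegree_le_two {p : ℝ[X]} (hp : p.natDegree ≤ 2) (t : K) :
    aeval t p = (p.coeff 2 : K) * t ^ 2 + p.coeff 1 * t + p.coeff 0 := by
  rw [aeval_eq_sum_range' (n := 3) (by omega)]
  simp [Finset.sum_range_succ, Algebra.smul_def]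
  ring

variable (hf : mapDegree f = 2)

include hf

theorem natDegree_num_le : f.num.natDegree ≤ 2 := hf ▸ le_max_left _ _

theorem natDegree_denom_le : f.denom.natDegree ≤ 2 := hf ▸ le_max_right _ _

theorem lift_mk_one (t : K) : (quadPair f).lift K (t, 1) = (aeval t f.num, aeval t f.denom) := by
  rw [aeval_of_natDegree_le_two (natDegree_num_le hf),
    aeval_of_natDegree_le_two (natDegree_denom_le hf)]
  simp [QuadPair.lift, quadPair]

theorem coeff_two_ne_zero : f.num.coeff 2 ≠ 0 ∨ f.denom.coeff 2 ≠ 0 := by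
  rcases le_total f.num.natDegree f.denom.natDegree with h | h
  · have h2 : f.denom.natDegree = 2 := by rw [← hf, mapDegree, max_eq_right h]
    right
    rw [← h2, coeff_natDegree, leadingCoeff_ne_zero]
    exact f.denom_ne_zero
  · have h2 : f.num.natDegree = 2 := by rw [← hf, mapDegree, max_eq_left h]
    left
    rw [← h2, coeff_natDegree, leadingCoeff_ne_zero]
    rintro h0
    simp [h0] at h2

/-- At `∞` the degree prevents a common zero of the two forms; at finite points a Bézout relation
does. -/
theorem lift_ne_zero {v : K × K} (hv : v ≠ 0) : (quadPair f).lift K v ≠ 0 := by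
  by_cases h2 : v.2 = 0
  · have h1 := pow_ne_zero 2 (fst_ne_zero_of_snd_eq_zero hv h2)
    intro h0
    have ha := congrArg Prod.fst h0
    have hb := congrArg Prod.snd h0
    simp only [QuadPair.lift, quadPair, h2, Prod.fst_zero, Prod.snd_zero] at ha hb
    rcases coeff_two_ne_zero hf with h | h
    · exact mul_ne_zero (RCLike.ofReal_ne_zero.2 h) h1 (by simpa using ha)
    · exact mul_ne_zero (RCLike.ofReal_ne_zero.2 h) h1 (by simpa using hb)
  · have hv2 : v = v.2 • (v.1 / v.2, (1 : K)) := by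
      ext
      · simp [mul_div_cancel₀ _ h2]
      · simp
    rw [hv2, QuadPair.lift_smul, lift_mk_one hf]
    refine smul_ne_zero (pow_ne_zero 2 h2) fun h0 => ?_
    obtain ⟨a, b, hab⟩ := f.isCoprime_num_denom
    have h3 := congrArg (aeval (v.1 / v.2)) hab
    have ha := congrArg Prod.fst h0
    have hb := congrArg Prod.snd h0
    simp only [Prod.fst_zero, Prod.snd_zero] at ha hb
    simp [ha, hb] at h3

theorem projMap_proj {v : K × K} (hv : v ≠ 0) :
    projMap K f (proj v) = proj ((quadPair f).lift K v) := by
  by_cases h2 : v.2 = 0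
  · have h1 := fst_ne_zero_of_snd_eq_zero hv h2
    have hv1 : v = v.1 • ((1 : K), (0 : K)) := by
      ext
      · simp
      · simp [h2]
    have h3 : (quadPair f).lift K (1, 0) = ((f.num.coeff 2 : K), (f.denom.coeff 2 : K)) := by
      simp [QuadPair.lift, quadPair]
    rw [proj_of_eq_zero h2, hv1, QuadPair.lift_smul, proj_smul (pow_ne_zero 2 h1), h3]
    simp only [projMap, OnePoint.elim_infty]
    split_ifs with hlt
    · have : f.denom.coeff 2 = 0 := coeff_eq_zero_of_natDegree_lt
        (lt_of_lt_of_le hlt (natDegree_num_le hf))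
      rw [proj_of_eq_zero (by simp [this])]
    · have h4 : f.denom.natDegree = 2 := by
        rw [← hf, mapDegree, max_eq_right (not_lt.1 hlt)]
      have h5 : f.denom.coeff 2 ≠ 0 := by
        rw [← h4, coeff_natDegree, leadingCoeff_ne_zero]
        exact f.denom_ne_zero
      rw [proj_of_ne_zero (by simpa using h5), h4]
      simp
  · have hv2 : v = v.2 • (v.1 / v.2, (1 : K)) := by
      ext
      · simp [mul_div_cancel₀ _ h2]
      · simp
    rw [hv2, QuadPair.lift_smul, proj_smul (pow_ne_zero 2 h2), proj_smul h2, proj_mk_one, lift_mk_one hf]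
    simp only [projMap, OnePoint.elim_some, proj]
    split_ifs <;> rfl

theorem continuous_projMap : Continuous (projMap K f) :=
  continuous_of_semiconj_proj (QuadPair.continuous_lift _) (fun _ => lift_ne_zero hf)
    (fun _ => projMap_proj hf)

/-- If `res = 0`, then `deckLift` squares to zero and kills some `y ≠ 0`, a column of its matrix
when `lead ≠ 0`. By `lift_cross` all values are then proportional to that at `y`, so the map is
constant, against coprimality and degree two. -/
theorem res_ne_zero : (quadPair f).res ≠ 0 := by
  intro h0
  set Φ := quadPair f with hΦ
  have hy : ∃ y : ℝ × ℝ, y ≠ 0 ∧ Φ.deckLift ℝ y = 0 := by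
    have hres : Φ.mid ^ 2 - Φ.lead * Φ.tail = 0 := h0
    by_cases hl : Φ.lead = 0
    · have hm : Φ.mid = 0 := by
        rw [hl] at hres
        nlinarith
      exact ⟨(1, 0), by simp, by simp [QuadPair.deckLift, hm, hl]⟩
    · refine ⟨(-Φ.mid, Φ.lead), fun h => hl (congrArg Prod.snd h), Prod.ext ?_ ?_⟩
      · simp only [QuadPair.deckLift, RCLike.ofReal_real_eq_id, id, Prod.fst_zero]
        linear_combination hres
      · simp only [QuadPair.deckLift, RCLike.ofReal_real_eq_id, id, Prod.snd_zero]
        ring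
  obtain ⟨y, hy, hy0⟩ := hy
  have hw := lift_ne_zero hf hy
  rw [← hΦ] at hw
  set w := Φ.lift ℝ y with hwdef
  have key : C w.1 * f.denom = C w.2 * f.num := by
    refine Polynomial.funext fun t => ?_
    have h1 := Φ.lift_cross y (t, 1)
    rw [hy0, lift_mk_one hf] at h1
    simp only [Prod.fst_zero, Prod.snd_zero, neg_zero, mul_zero, add_zero, ← hwdef,
      coe_aeval_eq_eval] at h1
    simp only [eval_mul, eval_C]
    linarith
  have hcop := f.isCoprime_num_denom
  have h1 : f.num ∣ C w.1 := hcop.dvd_of_dvd_mul_right ⟨C w.2, by rw [key, mul_comm]⟩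
  have h2 : f.denom ∣ C w.2 := hcop.symm.dvd_of_dvd_mul_right ⟨C w.1, by rw [← key, mul_comm]⟩
  have hdeg : f.num.natDegree = 0 ∧ f.denom.natDegree = 0 := by
    by_cases ha : w.1 = 0
    · have hb : w.2 ≠ 0 := fun hb => hw (Prod.ext ha hb)
      have hnum : f.num = 0 := by
        rw [ha, C_0, zero_mul] at key
        exact (mul_eq_zero.1 key.symm).resolve_left (C_ne_zero.2 hb)
      refine ⟨by rw [hnum, natDegree_zero], ?_⟩
      exact Nat.le_zero.1 ((natDegree_le_of_dvd h2 (C_ne_zero.2 hb)).trans_eq (natDegree_C _))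
    · have hb : w.2 ≠ 0 := by
        intro hb
        rw [hb, C_0, zero_mul] at key
        exact mul_ne_zero (C_ne_zero.2 ha) f.denom_ne_zero key
      exact ⟨Nat.le_zero.1 ((natDegree_le_of_dvd h1 (C_ne_zero.2 ha)).trans_eq (natDegree_C _)),
        Nat.le_zero.1 ((natDegree_le_of_dvd h2 (C_ne_zero.2 hb)).trans_eq (natDegree_C _))⟩
  rw [mapDegree, hdeg.1, hdeg.2] at hf
  simp at hf

end Coefficients

/-! ### The real circle in homogeneous coordinates -/

theorem circleIncl_proj (v : ℝ × ℝ) : circleIncl (proj v) = proj ((v.1 : ℂ), (v.2 : ℂ)) := by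
  by_cases h : v.2 = 0
  · rw [proj_of_eq_zero h, proj_of_eq_zero (by simp [h])]
    simp [circleIncl]
  · rw [proj_of_ne_zero h, proj_of_ne_zero (by simpa using h)]
    simp [circleIncl]

theorem continuous_circleIncl : Continuous circleIncl := by
  refine continuous_of_comp_proj fun v hv => ?_
  simp only [circleIncl_proj]
  refine ContinuousAt.comp (g := proj) (continuousAt_proj fun h => hv ?_) (by fun_prop)
  have h1 := congrArg Prod.fst h
  have h2 := congrArg Prod.snd h
  exact Prod.ext (by simpa using h1) (by simpa using h2)

theorem injective_circleIncl : Function.Injective circleIncl :=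
  Option.map_injective Complex.ofReal_injective

theorem isClosedEmbedding_circleIncl : IsClosedEmbedding circleIncl :=
  continuous_circleIncl.isClosedEmbedding injective_circleIncl

theorem proj_mem_realCircle_iff (v : ℂ × ℂ) :
    proj v ∈ realCircle ↔ (v.1 * star v.2).im = 0 := by
  by_cases h : v.2 = 0
  · simp only [proj_of_eq_zero h, h, star_zero, mul_zero, Complex.zero_im, iff_true]
    exact ⟨OnePoint.infty, rfl⟩
  · have h1 : (v.1 * star v.2).im = Complex.normSq v.2 * (v.1 / v.2).im := by
      have : v.1 * star v.2 = Complex.normSq v.2 * (v.1 / v.2) := by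
        rw [RCLike.star_def, Complex.normSq_eq_conj_mul_self]
        field_simp
      rw [this, Complex.im_ofReal_mul]
    rw [proj_of_ne_zero h, h1, mul_eq_zero, or_iff_right (Complex.normSq_pos.2 h).ne']
    constructor
    · rintro ⟨x, hx⟩
      induction x using OnePoint.rec with
      | infty => exact absurd hx.symm (OnePoint.coe_ne_infty _)
      | coe t =>
        rw [← OnePoint.coe_injective hx]
        exact Complex.ofReal_im t
    · intro him
      refine ⟨((v.1 / v.2).re : ℝ), ?_⟩
      simp only [circleIncl, OnePoint.map_some]
      exact congrArg OnePoint.some (Complex.ext (by simp) (by simp [him]))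

/-! ### Critical points -/

section Critical

variable {f : RatFunc ℝ} (hf : mapDegree f = 2)

theorem coord_infty_proj (w : ℂ × ℂ) : coord OnePoint.infty (proj w) = w.2 / w.1 := by
  by_cases h : w.2 = 0
  · simp [proj_of_eq_zero h, coord, h]
  · simp [proj_of_ne_zero h, coord]

theorem coord_coe_proj (b : ℂ) (w : ℂ × ℂ) : coord (OnePoint.some b) (proj w) = w.1 / w.2 := by
  by_cases h : w.2 = 0
  · simp [proj_of_eq_zero h, coord, h]
  · simp [proj_of_ne_zero h, coord]

theorem coordInv_coe (b : ℂ) (t : ℂ) : coordInv (OnePoint.some b) t = proj (t, 1) := by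
  simp [coordInv, proj_mk_one]

theorem coordInv_infty (t : ℂ) : coordInv OnePoint.infty t = proj (1, t) := by
  by_cases h : t = 0
  · simp [coordInv, h, proj_of_eq_zero]
  · rw [proj_of_ne_zero (by exact h)]
    simp [coordInv, h]

/-- In either coordinate of the target, the numerator in the quotient rule is the Wronskian of `a`
and `b` up to sign. -/
theorem hasDerivAt_coord_proj {a b : ℂ → ℂ} {a' b' t : ℂ} (ha : HasDerivAt a a' t)
    (hb : HasDerivAt b b' t) (hne : (a t, b t) ≠ 0) :
    HasDerivAt (fun s => coord (proj (a t, b t)) (proj (a s, b s))) 0 t ↔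
      a' * b t - a t * b' = 0 := by
  by_cases h : b t = 0
  · have ha0 : a t ≠ 0 := fst_ne_zero_of_snd_eq_zero hne h
    rw [proj_of_eq_zero (by exact h)]
    simp only [coord_infty_proj]
    have hd := hb.div ha ha0
    constructor
    · intro h0
      have := hd.unique h0
      rw [div_eq_zero_iff] at this
      have := this.resolve_right (pow_ne_zero 2 ha0)
      linear_combination -this
    · intro h0
      convert! hd using 1
      rw [eq_comm, div_eq_zero_iff]
      left
      linear_combination -h0
  · rw [proj_of_ne_zero (by exact h)]
    simp only [coord_coe_proj]
    have hd := ha.div hb h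
    constructor
    · intro h0
      have := hd.unique h0
      rw [div_eq_zero_iff] at this
      exact this.resolve_right (pow_ne_zero 2 h)
    · intro h0
      convert! hd using 1
      rw [h0, zero_div]

include hf in
theorem isCriticalPoint_proj_iff {v : ℂ × ℂ} (hv : v ≠ 0) :
    IsCriticalPoint (sphereMap f) (proj v) ↔ (quadPair f).critForm ℂ v = 0 := by
  set Φ := quadPair f
  by_cases h2 : v.2 = 0
  · have h1 := fst_ne_zero_of_snd_eq_zero hv h2
    have hv1 : v = v.1 • ((1 : ℂ), (0 : ℂ)) := by
      ext
      · simp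
      · simp [h2]
    rw [hv1, Φ.critForm_smul, proj_smul h1]
    simp only [mul_eq_zero, pow_eq_zero_iff, ne_eq, OfNat.ofNat_ne_zero, not_false_eq_true, h1,
      false_or]
    have hp : ∀ t : ℂ, sphereMap f (proj (1, t)) = proj (Φ.lift ℂ (1, t)) := fun t =>
      projMap_proj hf (by simp)
    have ha : HasDerivAt (fun t : ℂ => (Φ.lift ℂ (1, t)).1) Φ.p₁ 0 := by
      simp only [QuadPair.lift]
      have := ((hasDerivAt_id (0 : ℂ)).const_mul (Φ.p₁ : ℂ)).add
        (((hasDerivAt_id (0 : ℂ)).pow 2).const_mul (Φ.p₀ : ℂ))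
      convert! this.const_add (Φ.p₂ : ℂ) using 1
      · funext t
        simp [add_assoc]
      · simp
    have hb : HasDerivAt (fun t : ℂ => (Φ.lift ℂ (1, t)).2) Φ.q₁ 0 := by
      simp only [QuadPair.lift]
      have := ((hasDerivAt_id (0 : ℂ)).const_mul (Φ.q₁ : ℂ)).add
        (((hasDerivAt_id (0 : ℂ)).pow 2).const_mul (Φ.q₀ : ℂ))
      convert! this.const_add (Φ.q₂ : ℂ) using 1
      · funext t
        simp [add_assoc]
      · simp
    have hd := hasDerivAt_coord_proj ha hb (lift_ne_zero hf (v := ((1 : ℂ), (0 : ℂ))) (by simp))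
    have hc : coord OnePoint.infty (OnePoint.infty : OnePoint ℂ) = 0 := by simp [coord]
    rw [IsCriticalPoint, proj_one_zero, hc]
    simp only [coordInv_infty, hp]
    rw [← proj_one_zero, hp]
    refine hd.trans ?_
    simp only [QuadPair.lift, QuadPair.critForm, QuadPair.lead]
    push_cast
    constructor <;> intro h0 <;> linear_combination -h0
  · have hv2 : v = v.2 • (v.1 / v.2, (1 : ℂ)) := by
      ext
      · simp [mul_div_cancel₀ _ h2]
      · simp
    rw [hv2, Φ.critForm_smul, proj_smul h2]
    simp only [mul_eq_zero, pow_eq_zero_iff, ne_eq, OfNat.ofNat_ne_zero, not_false_eq_true, h2,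
      false_or]
    generalize v.1 / v.2 = z
    have hp : ∀ t : ℂ, sphereMap f (proj (t, 1)) = proj (Φ.lift ℂ (t, 1)) := fun t =>
      projMap_proj hf (by simp)
    have ha : HasDerivAt (fun t : ℂ => (Φ.lift ℂ (t, 1)).1) (2 * Φ.p₂ * z + Φ.p₁) z := by
      simp only [QuadPair.lift]
      have := (((hasDerivAt_id z).pow 2).const_mul (Φ.p₂ : ℂ)).add
        ((hasDerivAt_id z).const_mul (Φ.p₁ : ℂ))
      convert! this.add_const (Φ.p₀ : ℂ) using 1
      · funext t
        simp
      · simp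
        ring
    have hb : HasDerivAt (fun t : ℂ => (Φ.lift ℂ (t, 1)).2) (2 * Φ.q₂ * z + Φ.q₁) z := by
      simp only [QuadPair.lift]
      have := (((hasDerivAt_id z).pow 2).const_mul (Φ.q₂ : ℂ)).add
        ((hasDerivAt_id z).const_mul (Φ.q₁ : ℂ))
      convert! this.add_const (Φ.q₀ : ℂ) using 1
      · funext t
        simp
      · simp
        ring
    have hd := hasDerivAt_coord_proj ha hb (lift_ne_zero hf (v := (z, (1 : ℂ))) (by simp))
    have hc : coord (OnePoint.some z) (OnePoint.some z) = z := by simp [coord]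
    rw [IsCriticalPoint, proj_mk_one, hc]
    simp only [coordInv_coe, hp]
    rw [← proj_mk_one, hp]
    refine hd.trans ?_
    simp only [QuadPair.lift, QuadPair.critForm, QuadPair.lead, QuadPair.mid, QuadPair.tail]
    push_cast
    constructor <;> intro h0 <;> linear_combination h0

end Critical

/-! ### The deck involution -/

section Deck

theorem exists_smul_rep {K : Type*} [Field K] {v : K × K} (hv : v ≠ 0) :
    ∃ c : K, c ≠ 0 ∧ v = c • (proj v).elim ((1 : K), (0 : K)) (fun t => (t, 1)) := by
  by_cases h : v.2 = 0
  · refine ⟨v.1, fst_ne_zero_of_snd_eq_zero hv h, ?_⟩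
    rw [proj_of_eq_zero h]
    ext
    · simp
    · simp [h]
  · refine ⟨v.2, h, ?_⟩
    rw [proj_of_ne_zero h]
    ext
    · simp [mul_div_cancel₀ _ h]
    · simp

/-- The involution of the real circle which exchanges the points of the fibres of the map. -/
noncomputable def deck (Φ : QuadPair) (x : OnePoint ℝ) : OnePoint ℝ :=
  proj (Φ.deckLift ℝ (x.elim (1, 0) (fun t => (t, 1))))

theorem deck_proj (Φ : QuadPair) {v : ℝ × ℝ} (hv : v ≠ 0) :
    deck Φ (proj v) = proj (Φ.deckLift ℝ v) := by
  obtain ⟨c, hc, h⟩ := exists_smul_rep hv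
  conv_rhs => rw [h, Φ.deckLift_smul, proj_smul hc]
  rfl

variable {f : RatFunc ℝ} (hf : mapDegree f = 2)

include hf

theorem isDoubleCover_circleMap (hres : (quadPair f).res < 0) :
    IsDoubleCover (circleMap f) (deck (quadPair f)) where
  continuous_map := continuous_projMap hf
  continuous_deck := continuous_of_semiconj_proj (QuadPair.continuous_deckLift _)
    (fun _ => QuadPair.deckLift_ne_zero hres.ne) fun _ => deck_proj _
  deck_deck x := by
    obtain ⟨v, hv, rfl⟩ := exists_proj_eq x
    rw [deck_proj _ hv, deck_proj _ (QuadPair.deckLift_ne_zero hres.ne hv),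
      QuadPair.deckLift_deckLift, proj_smul (by simpa using hres.ne)]
  deck_ne x := by
    obtain ⟨v, hv, rfl⟩ := exists_proj_eq x
    rw [deck_proj _ hv, ne_eq, proj_eq_iff (QuadPair.deckLift_ne_zero hres.ne hv) hv]
    intro h
    refine QuadPair.critForm_ne_zero hres hv ?_
    rw [← QuadPair.cross_deckLift, h, sub_self]
  map_eq_iff x y := by
    obtain ⟨u, hu, rfl⟩ := exists_proj_eq x
    obtain ⟨v, hv, rfl⟩ := exists_proj_eq y
    rw [circleMap, projMap_proj hf hu, projMap_proj hf hv, deck_proj _ hu,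
      proj_eq_iff (lift_ne_zero hf hu) (lift_ne_zero hf hv), proj_eq_iff hv hu,
      proj_eq_iff hv (QuadPair.deckLift_ne_zero hres.ne hu), ← sub_eq_zero,
      QuadPair.lift_cross, mul_eq_zero]
    refine or_congr ?_ ?_
    · rw [sub_eq_zero, eq_comm]
    · constructor <;> intro h <;> linear_combination h
  surjective y := by
    obtain ⟨w, hw, rfl⟩ := exists_proj_eq y
    obtain ⟨v, hv, h⟩ := QuadPair.exists_lift_cross_eq_zero hres w
    exact ⟨proj v, by rw [circleMap, projMap_proj hf hv, proj_eq_iff (lift_ne_zero hf hv) hw, h]⟩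

/-- The fibre over `(s, t)` is given by a quadratic equation of discriminant `disc s t`, a form
which is definite or indefinite according to the sign of `res`. -/
theorem surjective_circleMap_iff :
    Function.Surjective (circleMap f) ↔ (quadPair f).res < 0 := by
  refine ⟨fun hs => ?_, fun h => (isDoubleCover_circleMap hf h).surjective⟩
  by_contra hcon
  have hpos : 0 < (quadPair f).res := lt_of_le_of_ne (not_lt.1 hcon) (res_ne_zero hf).symm
  obtain ⟨s, t, hst, hneg⟩ := QuadPair.exists_disc_neg hpos
  obtain ⟨x, hx⟩ := hs (proj (s, t))
  obtain ⟨v, hv, rfl⟩ := exists_proj_eq x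
  rw [circleMap, projMap_proj hf hv, proj_eq_iff (lift_ne_zero hf hv) hst] at hx
  exact QuadPair.lift_cross_ne_zero hneg hv hx

/-- Conversely, the image of a covering map is open and compact, hence all of the connected circle.
-/
theorem isCoveringMap_iff : Function.Surjective (circleMap f) ↔ IsCoveringMap (circleMap f) := by
  refine ⟨fun hs => (isDoubleCover_circleMap hf ((surjective_circleMap_iff hf).1 hs)).isCoveringMap,
    fun hc => ?_⟩
  have h1 : IsClopen (range (circleMap f)) :=
    ⟨(isCompact_range hc.continuous).isClosed, hc.isOpenMap.isOpen_range⟩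
  exact range_eq_univ.1 (h1.eq_univ (range_nonempty _))

theorem sphereMap_mem_realCircle_iff (hres : (quadPair f).res < 0) (z : OnePoint ℂ) :
    sphereMap f z ∈ realCircle ↔ z ∈ realCircle := by
  obtain ⟨v, hv, rfl⟩ := exists_proj_eq z
  have h := QuadPair.lead_mul_hermForm_pos hres hv
  rw [sphereMap, projMap_proj hf hv, proj_mem_realCircle_iff,
    proj_mem_realCircle_iff, QuadPair.im_lift, mul_eq_zero, or_iff_left]
  intro h0
  rw [h0, mul_zero] at h
  exact lt_irrefl _ h

theorem sphereMap_iterate_mem_realCircle_iff (hres : (quadPair f).res < 0) (n : ℕ)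
    (z : OnePoint ℂ) : (sphereMap f)^[n] z ∈ realCircle ↔ z ∈ realCircle := by
  induction n with
  | zero => rfl
  | succ n ih => rw [Function.iterate_succ_apply', sphereMap_mem_realCircle_iff hf hres, ih]

theorem isCriticalPoint_circleIncl_proj_iff {v : ℝ × ℝ} (hv : v ≠ 0) :
    IsCriticalPoint (sphereMap f) (circleIncl (proj v)) ↔ (quadPair f).critForm ℝ v = 0 := by
  have hv' : ((v.1 : ℂ), (v.2 : ℂ)) ≠ 0 := fun h => hv (Prod.ext
    (by simpa using congrArg Prod.fst h) (by simpa using congrArg Prod.snd h))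
  rw [circleIncl_proj, isCriticalPoint_proj_iff hf hv', ← Complex.ofReal_eq_zero]
  simp [QuadPair.critForm]

theorem surjective_iff_critical : Function.Surjective (circleMap f) ↔
    ∀ c : OnePoint ℂ, IsCriticalPoint (sphereMap f) c →
      ∀ n : ℕ, (sphereMap f)^[n] c ∉ realCircle := by
  rw [surjective_circleMap_iff hf]
  constructor
  · intro hres c hc n hn
    obtain ⟨x, rfl⟩ := (sphereMap_iterate_mem_realCircle_iff hf hres n c).1 hn
    obtain ⟨v, hv, rfl⟩ := exists_proj_eq x
    exact QuadPair.critForm_ne_zero hres hv ((isCriticalPoint_circleIncl_proj_iff hf hv).1 hc)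
  · intro h
    by_contra hcon
    have hpos : 0 < (quadPair f).res := lt_of_le_of_ne (not_lt.1 hcon) (res_ne_zero hf).symm
    obtain ⟨v, hv, h0⟩ := QuadPair.exists_critForm_eq_zero hpos
    exact h _ ((isCriticalPoint_circleIncl_proj_iff hf hv).2 h0) 0 ⟨_, rfl⟩

end Deck

/-! ### Normality criterion -/

/-- A family of maps which factors as `z ↦ G (p n, k n z)`, where `G` is continuous, the parameters
`p n` stay in a compact set and the holomorphic functions `k n` are bounded by one, is
equicontinuous. -/
theorem equicontinuousAt_of_bounded_holomorphic {Y Z : Type*} [UniformSpace Y]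
    [PseudoMetricSpace Z] {G : Z × ℂ → Y} {S : Set Z} (hS : IsCompact S)
    (hG : ContinuousOn G (S ×ˢ Metric.closedBall 0 1)) {Ω : Set ℂ} (hΩ : IsOpen Ω)
    {F : ℕ → ℂ → Y} {p : ℕ → Z} (hp : ∀ n, p n ∈ S) {k : ℕ → ℂ → ℂ}
    (hk : ∀ n, DifferentiableOn ℂ (k n) Ω) (hk1 : ∀ n, ∀ t ∈ Ω, ‖k n t‖ ≤ 1)
    (hF : ∀ n, ∀ t ∈ Ω, F n t = G (p n, k n t)) {t : ℂ} (ht : t ∈ Ω) :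
    EquicontinuousAt F t := by
  intro U hU
  have huc := (hS.prod (isCompact_closedBall (0 : ℂ) 1)).uniformContinuousOn_of_continuous hG
  have h1 := huc hU
  rw [mem_map, (Metric.uniformity_basis_dist.inf_principal _).mem_iff] at h1
  obtain ⟨δ, hδ, hδU⟩ := h1
  obtain ⟨R, hR, hRΩ⟩ := Metric.isOpen_iff.1 hΩ t ht
  filter_upwards [Metric.ball_mem_nhds t hR, Metric.ball_mem_nhds t
    (show 0 < δ * R / 2 by positivity)] with s hs hs' n
  have hsΩ := hRΩ hs
  rw [hF n t ht, hF n s hsΩ]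
  -- Values in the unit disc are at most `2` apart, so the Schwarz lemma gives a bound `2 / R` on
  -- difference quotients at `t` independent of `n`; this explains the radius `δ * R / 2`.
  have hmaps : MapsTo (k n) (Metric.ball t R) (Metric.closedBall (k n t) 2) := by
    intro u hu
    rw [mem_closedBall_iff_norm]
    have h2 := hk1 n u (hRΩ hu)
    have h3 := hk1 n t ht
    exact (norm_sub_le _ _).trans (by linarith)
  have hdist := Complex.dist_le_div_mul_dist_of_mapsTo_ball ((hk n).mono hRΩ) hmaps hs
  have hlt : dist (k n t) (k n s) < δ := by
    rw [dist_comm]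
    refine hdist.trans_lt ?_
    rw [Metric.mem_ball] at hs'
    rw [div_mul_eq_mul_div, div_lt_iff₀ hR]
    linarith
  refine @hδU ((p n, k n t), (p n, k n s)) ⟨?_, ⟨hp n, ?_⟩, ⟨hp n, ?_⟩⟩
  · simpa [Prod.dist_eq] using ⟨hδ, hlt⟩
  · exact mem_closedBall_zero_iff.2 (hk1 n t ht)
  · exact mem_closedBall_zero_iff.2 (hk1 n s hsΩ)

theorem proj_chart_mem_fatouSet {g : OnePoint ℂ → OnePoint ℂ} {x : OnePoint ℝ} {Ω : Set ℂ}
    (hΩ : IsOpen Ω) {Z : Type*} [PseudoMetricSpace Z] {G : Z × ℂ → OnePoint ℂ} {S : Set Z}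
    (hS : IsCompact S) (hG : ContinuousOn G (S ×ˢ Metric.closedBall 0 1))
    (h : ∀ n : ℕ, ∃ p ∈ S, ∃ k : ℂ → ℂ, DifferentiableOn ℂ k Ω ∧ (∀ t ∈ Ω, ‖k t‖ ≤ 1) ∧
      ∀ t ∈ Ω, g^[n] (proj (chart ℂ x t)) = G (p, k t)) {t : ℂ} (ht : t ∈ Ω) :
    proj (chart ℂ x t) ∈ fatouSet g := by
  let _ : UniformSpace (OnePoint ℂ) := uniformSpaceOfCompactR1
  have he := isOpenEmbedding_proj_chart (K := ℂ) x
  choose p hp k hk hk1 hF using h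
  refine ⟨(fun s : ℂ => proj (chart ℂ x s)) '' Ω, he.isOpenMap _ hΩ, ⟨t, ht, rfl⟩, ?_⟩
  rintro _ ⟨s, hs, rfl⟩
  refine EquicontinuousAt.equicontinuousWithinAt ?_ _
  have h1 := equicontinuousAt_of_bounded_holomorphic hS hG hΩ (p := p) hp hk hk1 hF hs
  intro U hU
  rw [← he.map_nhds_eq s, eventually_map]
  exact h1 U hU

section Fatou

variable {f : RatFunc ℝ} (hf : mapDegree f = 2)

theorem differentiable_lift (Φ : QuadPair) : Differentiable ℂ (Φ.lift ℂ) := by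
  unfold QuadPair.lift
  fun_prop

theorem differentiable_chart (x : OnePoint ℝ) : Differentiable ℂ (chart ℂ x) := by
  induction x using OnePoint.rec with
  | infty => exact (differentiable_const _).prodMk differentiable_id
  | coe r => exact ((differentiable_const _).add differentiable_id).prodMk (differentiable_const _)

include hf in
theorem iterate_lift_ne_zero {K : Type*} [RCLike K] {v : K × K} (hv : v ≠ 0) (n : ℕ) :
    ((quadPair f).lift K)^[n] v ≠ 0 := by
  induction n with
  | zero => exact hv
  | succ n ih =>
    rw [Function.iterate_succ_apply']
    exact lift_ne_zero hf ih

include hf in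
theorem iterate_projMap_proj {K : Type*} [RCLike K] {v : K × K} (hv : v ≠ 0) (n : ℕ) :
    (projMap K f)^[n] (proj v) = proj (((quadPair f).lift K)^[n] v) := by
  induction n with
  | zero => rfl
  | succ n ih =>
    rw [Function.iterate_succ_apply', Function.iterate_succ_apply', ih,
      projMap_proj hf (iterate_lift_ne_zero hf hv n)]

/-! ### The complement of the real circle -/

/-- By `im_lift` and definiteness, each step keeps or reverses the sign of the imaginary part
according to the sign of `lead` alone, so an iterate sends a half-plane into a single half-plane. -/
theorem exists_sign_im_iterate (Φ : QuadPair) (hres : Φ.res < 0) {ε : ℝ}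
    (hε : ε = 1 ∨ ε = -1) (n : ℕ) : ∃ e : ℝ, (e = 1 ∨ e = -1) ∧ ∀ v : ℂ × ℂ,
      0 < ε * (v.1 * star v.2).im →
        0 < e * (((Φ.lift ℂ)^[n] v).1 * star ((Φ.lift ℂ)^[n] v).2).im := by
  induction n with
  | zero => exact ⟨ε, hε, fun v hv => hv⟩
  | succ n ih =>
    obtain ⟨e, he, h⟩ := ih
    have hpos : ∀ v : ℂ × ℂ, 0 < ε * (v.1 * star v.2).im →
        0 < Φ.lead * Φ.hermForm ((Φ.lift ℂ)^[n] v) := fun v hv => by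
      refine QuadPair.lead_mul_hermForm_pos hres fun h0 => ?_
      have := h v hv
      rw [h0] at this
      simp at this
    simp only [Function.iterate_succ_apply', QuadPair.im_lift]
    rcases lt_or_gt_of_ne (QuadPair.lead_ne_zero hres) with hl | hl
    · refine ⟨-e, by rcases he with rfl | rfl <;> simp, fun v hv => ?_⟩
      have h1 := h v hv
      have h2 : Φ.hermForm ((Φ.lift ℂ)^[n] v) < 0 := neg_of_mul_pos_right (hpos v hv) hl.le
      nlinarith [mul_pos h1 (neg_pos.2 h2)]
    · refine ⟨e, he, fun v hv => ?_⟩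
      have h1 := h v hv
      have h2 : 0 < Φ.hermForm ((Φ.lift ℂ)^[n] v) := pos_of_mul_pos_right (hpos v hv) hl.le
      nlinarith [mul_pos h1 h2]

theorem normSq_add_sub_normSq_sub (e : ℝ) (a b : ℂ) :
    Complex.normSq (a + Complex.I * e * b) - Complex.normSq (a - Complex.I * e * b) =
      4 * (e * (a * star b).im) := by
  obtain ⟨x, y⟩ := a
  obtain ⟨u, v⟩ := b
  simp only [Complex.normSq_apply, RCLike.star_def, Complex.mul_im, Complex.add_im, Complex.sub_im,
    Complex.mul_re, Complex.add_re, Complex.sub_re, Complex.ofReal_re, Complex.ofReal_im,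
    Complex.conj_re, Complex.conj_im, Complex.I_re, Complex.I_im]
  ring

include hf in
theorem mem_fatouSet_of_notMem_realCircle (hres : (quadPair f).res < 0) {z : OnePoint ℂ}
    (hz : z ∉ realCircle) : z ∈ fatouSet (sphereMap f) := by
  set Φ := quadPair f with hΦ
  have hI := Complex.I_ne_zero
  induction z using OnePoint.rec with
  | infty => exact absurd ⟨OnePoint.infty, rfl⟩ hz
  | coe z =>
    rw [← proj_mk_one, proj_mem_realCircle_iff] at hz
    simp only [star_one, mul_one] at hz
    obtain ⟨ε, hε, hεz⟩ : ∃ ε : ℝ, (ε = 1 ∨ ε = -1) ∧ 0 < ε * z.im := by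
      rcases lt_or_gt_of_ne hz with h | h
      · exact ⟨-1, Or.inr rfl, by linarith⟩
      · exact ⟨1, Or.inl rfl, by linarith⟩
    have hchart : ∀ t : ℂ, chart ℂ ((0 : ℝ) : OnePoint ℝ) t = (t, 1) := fun t => by
      simp [chart]
    have hΩ : IsOpen {t : ℂ | 0 < ε * t.im} :=
      isOpen_lt continuous_const (continuous_const.mul Complex.continuous_im)
    -- The map `G` is the inverse Cayley transform `k ↦ i e (1 + k) / (1 - k)`; its parameter `e =
    -- ±1` records the half-plane which contains the values of the iterate.
    have key := proj_chart_mem_fatouSet (g := sphereMap f) (x := ((0 : ℝ) : OnePoint ℝ)) hΩ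
      (G := fun p : ℝ × ℂ => proj (Complex.I * p.1 * (1 + p.2), 1 - p.2)) (S := {1, -1})
      (Set.toFinite _).isCompact ?_ ?_ (t := z) hεz
    · rwa [hchart, proj_mk_one] at key
    · rintro ⟨e, k⟩ ⟨he, -⟩
      refine ContinuousAt.continuousWithinAt (ContinuousAt.comp (g := proj)
        (continuousAt_proj fun h0 => ?_) (by fun_prop))
      have h1 := congrArg Prod.fst h0
      have h2 := congrArg Prod.snd h0
      simp only [Prod.fst_zero, Prod.snd_zero] at h1 h2
      have he0 : (e : ℂ) ≠ 0 := by
        rcases he with he | he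
        · simp [show e = 1 from he]
        · simp [show e = -1 from he]
      have h3 : (1 : ℂ) + k = 0 := (mul_eq_zero.1 h1).resolve_left (mul_ne_zero hI he0)
      have : (2 : ℂ) = 0 := by linear_combination h2 + h3
      norm_num at this
    · intro n
      obtain ⟨e, he, h⟩ := exists_sign_im_iterate Φ hres hε n
      have he0 : (e : ℂ) ≠ 0 := by rcases he with rfl | rfl <;> simp
      have hd : Differentiable ℂ fun t : ℂ => (Φ.lift ℂ)^[n] (chart ℂ ((0 : ℝ) : OnePoint ℝ) t) :=
        ((differentiable_lift Φ).iterate n).comp (differentiable_chart _)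
      set w := fun t : ℂ => (Φ.lift ℂ)^[n] (chart ℂ ((0 : ℝ) : OnePoint ℝ) t) with hw
      have hwt : ∀ t ∈ {t : ℂ | 0 < ε * t.im}, 0 < e * ((w t).1 * star (w t).2).im := by
        intro t ht
        refine h _ ?_
        rw [hchart]
        simpa using ht
      have hlt : ∀ t ∈ {t : ℂ | 0 < ε * t.im},
          ‖(w t).1 - Complex.I * e * (w t).2‖ < ‖(w t).1 + Complex.I * e * (w t).2‖ := by
        intro t ht
        have h1 := normSq_add_sub_normSq_sub e (w t).1 (w t).2
        have h2 := hwt t ht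
        rw [Complex.normSq_eq_norm_sq, Complex.normSq_eq_norm_sq] at h1
        refine lt_of_pow_lt_pow_left₀ 2 (norm_nonneg _) ?_
        linarith
      have hne : ∀ t ∈ {t : ℂ | 0 < ε * t.im}, (w t).1 + Complex.I * e * (w t).2 ≠ 0 :=
        fun t ht => norm_pos_iff.1 ((norm_nonneg _).trans_lt (hlt t ht))
      refine ⟨e, by rcases he with rfl | rfl <;> simp, fun t =>
        ((w t).1 - Complex.I * e * (w t).2) / ((w t).1 + Complex.I * e * (w t).2), ?_, ?_, ?_⟩
      · refine DifferentiableOn.div ?_ ?_ hne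
        · exact (hd.fst.sub (hd.snd.const_mul _)).differentiableOn
        · exact (hd.fst.add (hd.snd.const_mul _)).differentiableOn
      · intro t ht
        rw [norm_div, div_le_one (norm_pos_iff.2 (hne t ht))]
        exact (hlt t ht).le
      · intro t ht
        have h1 := hne t ht
        rw [sphereMap, iterate_projMap_proj hf (chart_ne_zero _ _)]
        change proj (w t) = _
        rw [← proj_smul (c := 2 * Complex.I * e / ((w t).1 + Complex.I * e * (w t).2))
          (div_ne_zero (mul_ne_zero (mul_ne_zero two_ne_zero hI) he0) h1) (w t)]
        congr 1
        ext
        · simp only [Prod.smul_fst, smul_eq_mul]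
          field_simp
          ring
        · simp only [Prod.smul_snd, smul_eq_mul]
          field_simp
          ring

/-! ### The points of the real circle -/

theorem exists_sign_of_ne_zero {s : Set ℝ} (hs : IsPreconnected s) {φ : ℝ → ℝ}
    (hφ : Continuous φ) (hne : ∀ t ∈ s, φ t ≠ 0) :
    ∃ σ : ℝ, (σ = 1 ∨ σ = -1) ∧ ∀ t ∈ s, 0 < σ * φ t := by
  by_cases h : ∀ t ∈ s, 0 < φ t
  · exact ⟨1, Or.inl rfl, fun t ht => by simpa using h t ht⟩
  · push Not at h
    obtain ⟨a, ha, ha0⟩ := h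
    refine ⟨-1, Or.inr rfl, fun t ht => ?_⟩
    by_contra hcon
    obtain ⟨u, hu, hu0⟩ := hs.intermediate_value ha ht hφ.continuousOn
      (show (0 : ℝ) ∈ Icc (φ a) (φ t) from ⟨ha0, by linarith⟩)
    exact hne u hu hu0

/-- The inclusion of `ℝ²` in `ℂ²`. -/
def complexify (v : ℝ × ℝ) : ℂ × ℂ := ((v.1 : ℂ), (v.2 : ℂ))

theorem chart_ofReal (x : OnePoint ℝ) (t : ℝ) : chart ℂ x (t : ℂ) = complexify (chart ℝ x t) := by
  induction x using OnePoint.rec with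
  | infty => simp [chart, complexify]
  | coe r => simp [chart, complexify]

theorem proj_chart_zero_complex (x : OnePoint ℝ) : proj (chart ℂ x 0) = circleIncl x := by
  rw [← Complex.ofReal_zero, chart_ofReal, complexify, ← circleIncl_proj, proj_chart_zero]

theorem iterate_lift_complexify (Φ : QuadPair) (n : ℕ) (v : ℝ × ℝ) :
    (Φ.lift ℂ)^[n] (complexify v) = complexify ((Φ.lift ℝ)^[n] v) := by
  induction n with
  | zero => rfl
  | succ n ih =>
    rw [Function.iterate_succ_apply', ih, Function.iterate_succ_apply']
    simp [QuadPair.lift, complexify]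

theorem im_chart_ne_zero (x : OnePoint ℝ) {t : ℂ} (ht : t.im ≠ 0) :
    ((chart ℂ x t).1 * star (chart ℂ x t).2).im ≠ 0 := by
  induction x using OnePoint.rec with
  | infty => simpa [chart] using ht
  | coe r => simpa [chart] using ht

/-- The sphere-valued map which recovers an iterate from its normalised form in the unit disc: the
disc is mapped onto the complement of an arc of the real circle with end points `u` and `τ u`. -/
noncomputable def arcMap (Φ : QuadPair) (q : ((ℝ × ℝ) × ℝ) × ℂ) : OnePoint ℂ :=
  proj ((Φ.deckLift ℝ q.1.1).1 * (q.1.2 * (1 + q.2) ^ 2) - q.1.1.1 * (1 - q.2) ^ 2,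
    (Φ.deckLift ℝ q.1.1).2 * (q.1.2 * (1 + q.2) ^ 2) - q.1.1.2 * (1 - q.2) ^ 2)

/-- Since `u` and `deckLift u` are independent, both coordinates vanish only if `1 + k` and `1 - k`
do. Continuity in the parameter `u` is what makes the normality uniform. -/
theorem continuousAt_arcMap {Φ : QuadPair} (hres : Φ.res < 0) {u : ℝ × ℝ} (hu : u ≠ 0) {σ : ℝ}
    (hσ : σ ≠ 0) (k : ℂ) : ContinuousAt (arcMap Φ) ((u, σ), k) := by
  refine ContinuousAt.comp (g := proj) (continuousAt_proj fun h0 => ?_) ?_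
  · have h1 := congrArg Prod.fst h0
    have h2 := congrArg Prod.snd h0
    simp only [Prod.fst_zero, Prod.snd_zero] at h1 h2
    have hc : ((Φ.critForm ℝ u : ℝ) : ℂ) ≠ 0 := by
      exact_mod_cast QuadPair.critForm_ne_zero hres hu
    have hcr : ((Φ.critForm ℝ u : ℝ) : ℂ) =
        u.1 * (Φ.deckLift ℝ u).2 - (Φ.deckLift ℝ u).1 * u.2 := by
      rw [← QuadPair.cross_deckLift]
      push_cast
      ring
    have hσ' : (σ : ℂ) ≠ 0 := by exact_mod_cast hσ
    have h3 : ((Φ.critForm ℝ u : ℝ) : ℂ) * (σ * (1 + k) ^ 2) = 0 := by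
      rw [hcr]
      linear_combination u.1 * h2 - u.2 * h1
    have h4 : ((Φ.critForm ℝ u : ℝ) : ℂ) * (1 - k) ^ 2 = 0 := by
      rw [hcr]
      linear_combination (Φ.deckLift ℝ u).1 * h2 - (Φ.deckLift ℝ u).2 * h1
    have h5 : 1 + k = 0 := by
      simpa [hc, hσ'] using h3
    have h6 : 1 - k = 0 := by
      simpa [hc] using h4
    have : (2 : ℂ) = 0 := by linear_combination h5 + h6
    norm_num at this
  · have h1 : Continuous fun q : ((ℝ × ℝ) × ℝ) × ℂ => Φ.deckLift ℝ q.1.1 :=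
      Φ.continuous_deckLift.comp (by fun_prop)
    fun_prop

/-- On the slit plane the principal square root has positive real part, and the Cayley transform
takes the right half-plane into the disc. -/
theorem sqrt_to_disc {s : ℂ} (hs : s ∈ Complex.slitPlane) :
    s ^ (1 / 2 : ℂ) + 1 ≠ 0 ∧ ‖(s ^ (1 / 2 : ℂ) - 1) / (s ^ (1 / 2 : ℂ) + 1)‖ ≤ 1 ∧
      (s ^ (1 / 2 : ℂ)) ^ 2 = s := by
  have hs0 := Complex.slitPlane_ne_zero hs
  have hre : 0 < (s ^ (1 / 2 : ℂ)).re := by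
    rw [Complex.cpow_def_of_ne_zero hs0, Complex.exp_re]
    refine mul_pos (Real.exp_pos _) (Real.cos_pos_of_mem_Ioo ?_)
    have him : (Complex.log s * (1 / 2)).im = s.arg / 2 := by
      rw [show (1 / 2 : ℂ) = ((1 / 2 : ℝ) : ℂ) by norm_num, Complex.im_mul_ofReal, Complex.log_im]
      ring
    rw [him]
    have h1 := Complex.neg_pi_lt_arg s
    have h2 := (Complex.arg_le_pi s).lt_of_ne (Complex.mem_slitPlane_iff_arg.1 hs).1
    constructor <;> linarith
  have hsq : (s ^ (1 / 2 : ℂ)) ^ 2 = s := by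
    rw [← Complex.cpow_nat_mul]
    norm_num
  generalize s ^ (1 / 2 : ℂ) = h at hre hsq
  have hne : h + 1 ≠ 0 := fun h0 => by
    have := congrArg Complex.re h0
    simp at this
    linarith
  refine ⟨hne, ?_, hsq⟩
  rw [norm_div, div_le_one (norm_pos_iff.2 hne)]
  refine le_of_sq_le_sq ?_ (norm_nonneg _)
  rw [← Complex.normSq_eq_norm_sq, ← Complex.normSq_eq_norm_sq, Complex.normSq_apply,
    Complex.normSq_apply]
  simp only [Complex.sub_re, Complex.sub_im, Complex.add_re, Complex.add_im, Complex.one_re,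
    Complex.one_im]
  nlinarith

end Fatou

/-! ### The Julia set as the image of the expanding set -/

section Julia

variable {f : RatFunc ℝ} (hf : mapDegree f = 2)

include hf

/-- An iterate which, on a real interval, omits the two points `u` and `τ u` of the circle, factors
on the disc over that interval through `arcMap`. -/
theorem exists_factor_arcMap (hres : (quadPair f).res < 0) (x : OnePoint ℝ) (ρ : ℝ) (n : ℕ)
    {u : ℝ × ℝ} (hu : u ≠ 0)
    (h₁ : ∀ t ∈ Metric.ball (0 : ℝ) ρ, (circleMap f)^[n] (proj (chart ℝ x t)) ≠ proj u)
    (h₂ : ∀ t ∈ Metric.ball (0 : ℝ) ρ,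
      (circleMap f)^[n] (proj (chart ℝ x t)) ≠ proj ((quadPair f).deckLift ℝ u)) :
    ∃ σ : ℝ, (σ = 1 ∨ σ = -1) ∧ ∃ k : ℂ → ℂ, DifferentiableOn ℂ k (Metric.ball 0 ρ) ∧
      (∀ t ∈ Metric.ball (0 : ℂ) ρ, ‖k t‖ ≤ 1) ∧ ∀ t ∈ Metric.ball (0 : ℂ) ρ,
        (sphereMap f)^[n] (proj (chart ℂ x t)) = arcMap (quadPair f) ((u, σ), k t) := by
  set Φ := quadPair f with hΦ
  set d := Φ.deckLift ℝ u with hd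
  have hd0 : d ≠ 0 := QuadPair.deckLift_ne_zero hres.ne hu
  have hc := QuadPair.critForm_ne_zero hres hu
  have hcr : u.1 * d.2 - d.1 * u.2 = Φ.critForm ℝ u := Φ.cross_deckLift u
  set r := fun t : ℝ => (Φ.lift ℝ)^[n] (chart ℝ x t) with hr
  set w := fun t : ℂ => (Φ.lift ℂ)^[n] (chart ℂ x t) with hw
  have hrw : ∀ t : ℝ, w t = complexify (r t) := fun t => by
    simp only [hw, hr, chart_ofReal, iterate_lift_complexify]
  have hr0 : ∀ t, r t ≠ 0 := fun t => iterate_lift_ne_zero hf (chart_ne_zero x t) n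
  have hrc : Continuous r := (Φ.continuous_lift.iterate n).comp (continuous_chart x)
  have hA : ∀ t ∈ Metric.ball (0 : ℝ) ρ, (r t).1 * u.2 - u.1 * (r t).2 ≠ 0 := by
    intro t ht h0
    refine h₁ t ht ?_
    rw [circleMap, iterate_projMap_proj hf (chart_ne_zero x t), proj_eq_iff (hr0 t) hu]
    exact sub_eq_zero.1 h0
  have hB : ∀ t ∈ Metric.ball (0 : ℝ) ρ, (r t).1 * d.2 - d.1 * (r t).2 ≠ 0 := by
    intro t ht h0
    refine h₂ t ht ?_
    rw [circleMap, iterate_projMap_proj hf (chart_ne_zero x t), proj_eq_iff (hr0 t) hd0]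
    exact sub_eq_zero.1 h0
  -- `σ` is the constant sign of `A / B` on the real interval, where `A` and `B` below vanish
  -- exactly when the iterate hits `u` or `τ u`.
  obtain ⟨σ, hσ, hσpos⟩ := exists_sign_of_ne_zero (convex_ball (0 : ℝ) ρ).isPreconnected
    (φ := fun t => ((r t).1 * u.2 - u.1 * (r t).2) * ((r t).1 * d.2 - d.1 * (r t).2))
    (by fun_prop) fun t ht => mul_ne_zero (hA t ht) (hB t ht)
  have hσ0 : σ ≠ 0 := by rcases hσ with rfl | rfl <;> norm_num
  set A := fun t : ℂ => (w t).1 * u.2 - u.1 * (w t).2 with hAdef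
  set B := fun t : ℂ => (w t).1 * d.2 - d.1 * (w t).2 with hBdef
  have hAr : ∀ t : ℝ, A t = (((r t).1 * u.2 - u.1 * (r t).2 : ℝ) : ℂ) := fun t => by
    simp [hAdef, hrw, complexify]
  have hBr : ∀ t : ℝ, B t = (((r t).1 * d.2 - d.1 * (r t).2 : ℝ) : ℂ) := fun t => by
    simp [hBdef, hrw, complexify]
  -- Passing from `w` to `(A, B)` is a real linear change of coordinates of determinant `critForm
  -- u`. So off the real axis `A / B` is not real, and `σ * (A / B)` avoids the negative axis on the
  -- whole disc.
  have him : ∀ t : ℂ, (A t * star (B t)).im = Φ.critForm ℝ u * ((w t).1 * star (w t).2).im := by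
    intro t
    rw [← hcr]
    simp only [hAdef, hBdef]
    obtain ⟨⟨a, b⟩, ⟨c, e⟩⟩ := w t
    simp only [RCLike.star_def, Complex.mul_im, Complex.sub_im, Complex.mul_re, Complex.sub_re,
      Complex.ofReal_re, Complex.ofReal_im, Complex.conj_re, Complex.conj_im]
    ring
  have hw_im : ∀ t : ℂ, t.im ≠ 0 → ((w t).1 * star (w t).2).im ≠ 0 := by
    intro t ht h0
    rw [← proj_mem_realCircle_iff] at h0
    simp only [hw, hΦ] at h0
    rw [← iterate_projMap_proj hf (chart_ne_zero x t)] at h0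
    have := (sphereMap_iterate_mem_realCircle_iff hf hres n _).1 h0
    rw [proj_mem_realCircle_iff] at this
    exact im_chart_ne_zero x ht this
  have hAB : ∀ t ∈ Metric.ball (0 : ℂ) ρ, B t ≠ 0 ∧ σ * (A t / B t) ∈ Complex.slitPlane := by
    intro t ht
    by_cases hti : t.im = 0
    · obtain ⟨s, rfl⟩ : ∃ s : ℝ, t = s := ⟨t.re, Complex.ext rfl (by simpa using hti)⟩
      have hs : s ∈ Metric.ball (0 : ℝ) ρ := by simpa using ht
      rw [hAr, hBr]
      refine ⟨by exact_mod_cast hB s hs, ?_⟩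
      rw [← Complex.ofReal_div, ← Complex.ofReal_mul, Complex.ofReal_mem_slitPlane]
      have h1 := hσpos s hs
      have h2 : σ * (((r s).1 * u.2 - u.1 * (r s).2) / ((r s).1 * d.2 - d.1 * (r s).2)) =
          σ * (((r s).1 * u.2 - u.1 * (r s).2) * ((r s).1 * d.2 - d.1 * (r s).2)) /
            ((r s).1 * d.2 - d.1 * (r s).2) ^ 2 := by
        have := hB s hs
        field_simp
      rw [h2]
      exact div_pos h1 (sq_pos_of_ne_zero (hB s hs))
    · have h1 : (A t * star (B t)).im ≠ 0 := by
        rw [him]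
        exact mul_ne_zero hc (hw_im t hti)
      have hB0 : B t ≠ 0 := fun h0 => h1 (by simp [h0])
      refine ⟨hB0, Or.inr ?_⟩
      have h2 : A t * star (B t) = Complex.normSq (B t) * (A t / B t) := by
        rw [RCLike.star_def, Complex.normSq_eq_conj_mul_self]
        field_simp
      rw [h2, Complex.im_ofReal_mul] at h1
      rw [Complex.im_ofReal_mul]
      exact mul_ne_zero hσ0 (right_ne_zero_of_mul h1)
  have hwd : Differentiable ℂ w := ((differentiable_lift Φ).iterate n).comp (differentiable_chart x)
  have hAd : Differentiable ℂ A := (hwd.fst.mul_const _).sub (hwd.snd.const_mul _)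
  have hBd : Differentiable ℂ B := (hwd.fst.mul_const _).sub (hwd.snd.const_mul _)
  have hsd : DifferentiableOn ℂ (fun t => (σ * (A t / B t)) ^ (1 / 2 : ℂ)) (Metric.ball 0 ρ) := by
    refine DifferentiableOn.cpow_const ?_ fun t ht => (hAB t ht).2
    exact (hAd.differentiableOn.div hBd.differentiableOn fun t ht => (hAB t ht).1).const_mul _
  refine ⟨σ, hσ, fun t => ((σ * (A t / B t)) ^ (1 / 2 : ℂ) - 1) /
    ((σ * (A t / B t)) ^ (1 / 2 : ℂ) + 1), ?_, ?_, ?_⟩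
  · exact (hsd.sub_const _).div (hsd.add_const _) fun t ht => (sqrt_to_disc (hAB t ht).2).1
  · exact fun t ht => (sqrt_to_disc (hAB t ht).2).2.1
  · intro t ht
    obtain ⟨hB0, hslit⟩ := hAB t ht
    obtain ⟨h1, -, hsq⟩ := sqrt_to_disc hslit
    dsimp only
    generalize (σ * (A t / B t)) ^ (1 / 2 : ℂ) = h at h1 hsq
    have hσσ : (σ : ℂ) * σ = 1 := by rcases hσ with rfl | rfl <;> simp
    have hsq' : (σ : ℂ) * h ^ 2 * B t = A t := by
      rw [hsq]
      field_simp
      linear_combination (A t) * hσσ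
    have hcC : ((Φ.critForm ℝ u : ℝ) : ℂ) = u.1 * d.2 - d.1 * u.2 := by
      rw [← hcr]
      push_cast
      ring
    have hc0 : ((Φ.critForm ℝ u : ℝ) : ℂ) ≠ 0 := by exact_mod_cast hc
    rw [sphereMap, iterate_projMap_proj hf (chart_ne_zero _ _)]
    change proj (w t) = proj _
    -- Rescaling by the identity `A d - B u = -critForm(u) w`, which recovers `w` from `A` and `B`.
    rw [← proj_smul (c := -(Φ.critForm ℝ u : ℝ) * (4 / (B t * (h + 1) ^ 2)))
      (mul_ne_zero (neg_ne_zero.2 hc0) (div_ne_zero (by norm_num)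
        (mul_ne_zero hB0 (pow_ne_zero 2 h1)))) (w t)]
    have e1 : 1 + (h - 1) / (h + 1) = 2 * h / (h + 1) := by
      field_simp
      ring
    have e2 : 1 - (h - 1) / (h + 1) = 2 / (h + 1) := by
      field_simp
      ring
    have e3 : ∀ a b : ℝ, (a : ℂ) * (σ * (2 * h / (h + 1)) ^ 2) - b * (2 / (h + 1)) ^ 2 =
        (a * A t - b * B t) * (4 / (B t * (h + 1) ^ 2)) := by
      intro a b
      rw [← hsq']
      field_simp
      ring
    congr 1
    ext
    · simp only [Prod.smul_fst, smul_eq_mul]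
      rw [e1, e2, e3, hcC]
      simp only [hAdef, hBdef]
      ring
    · simp only [Prod.smul_snd, smul_eq_mul]
      rw [e1, e2, e3, hcC]
      simp only [hAdef, hBdef]
      ring

theorem circleIncl_mem_fatouSet (hres : (quadPair f).res < 0) {x : OnePoint ℝ}
    (hx : x ∉ expandingSet (circleMap f)) : circleIncl x ∈ fatouSet (sphereMap f) := by
  have hdc := isDoubleCover_circleMap hf hres
  simp only [expandingSet, mem_ofPred_eq, not_forall, not_exists] at hx
  obtain ⟨N, hN, hxN, hne⟩ := hx
  obtain ⟨ρ, hρ, hρN⟩ := (hasBasis_nhds_circle x).mem_iff.1 (hN.mem_nhds hxN)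
  rw [← proj_chart_zero_complex]
  refine proj_chart_mem_fatouSet (Ω := Metric.ball 0 ρ) Metric.isOpen_ball
    (G := arcMap (quadPair f)) (S := Metric.sphere (0 : ℝ × ℝ) 1 ×ˢ ({1, -1} : Set ℝ))
    ((isCompact_sphere _ _).prod (Set.toFinite _).isCompact) ?_ (fun n => ?_)
    (Metric.mem_ball_self hρ)
  · rintro ⟨⟨u, σ⟩, k⟩ ⟨⟨hu, hσ⟩, -⟩
    refine (continuousAt_arcMap hres ?_ ?_ k).continuousWithinAt
    · exact norm_ne_zero_iff.1 (by rw [mem_sphere_zero_iff_norm.1 hu]; exact one_ne_zero)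
    · rcases hσ with hσ | hσ
      · simp [show σ = 1 from hσ]
      · simp [show σ = -1 from hσ]
  -- A value missed at time `n + 1` has both its preimages `u` and `τ u` missed at time `n`.
  -- Normalising `u` keeps the parameters in a compact set.
  · obtain ⟨y, hy⟩ := (ne_univ_iff_exists_notMem _).1 (hne (n + 1))
    obtain ⟨z, rfl⟩ := hdc.surjective y
    obtain ⟨v, hv, rfl⟩ := exists_proj_eq z
    have hn : ‖v‖ ≠ 0 := norm_ne_zero_iff.2 hv
    have hu1 : ‖‖v‖⁻¹ • v‖ = 1 := by
      rw [norm_smul, norm_inv, norm_norm, inv_mul_cancel₀ hn]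
    rw [← proj_smul (inv_ne_zero hn)] at hy
    set u := ‖v‖⁻¹ • v
    have hu : u ≠ 0 := norm_ne_zero_iff.1 (by rw [hu1]; exact one_ne_zero)
    have omit_of : ∀ z, circleMap f z = circleMap f (proj u) → ∀ t ∈ Metric.ball (0 : ℝ) ρ,
        (circleMap f)^[n] (proj (chart ℝ x t)) ≠ z := by
      rintro z hz t ht rfl
      refine hy ⟨_, hρN ⟨t, ht, rfl⟩, ?_⟩
      rw [Function.iterate_succ_apply', hz]
    obtain ⟨σ, hσ, k, hk, hk1, hkF⟩ := exists_factor_arcMap hf hres x ρ n hu (omit_of _ rfl)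
      (omit_of _ (by rw [← deck_proj _ hu, hdc.map_deck]))
    exact ⟨(u, σ), ⟨mem_sphere_zero_iff_norm.2 hu1, hσ⟩, k, hk, hk1, hkF⟩

omit hf in
theorem circleIncl_iterate (f : RatFunc ℝ) (n : ℕ) (x : OnePoint ℝ) :
    circleIncl ((circleMap f)^[n] x) = (sphereMap f)^[n] (circleIncl x) :=
  Function.Semiconj.iterate_right (f := circleIncl) (circleIncl_circleMap f) n x

omit hf in
theorem equicontinuousAt_of_mem_fatouSet {X : Type*} [TopologicalSpace X] [CompactSpace X]
    [T2Space X] {g : X → X} {x : X} (hx : x ∈ fatouSet g) :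
    letI : UniformSpace X := uniformSpaceOfCompactR1
    EquicontinuousAt (fun n : ℕ => g^[n]) x := by
  let _ : UniformSpace X := uniformSpaceOfCompactR1
  obtain ⟨U, hU, hxU, h⟩ := hx
  intro V hV
  have := h x hxU V hV
  rwa [hU.nhdsWithin_eq hxU] at this

omit hf in
-- Equicontinuity would give a neighbourhood with uniformly small images, but some image covers the
-- circle and so contains both `0` and `∞`.
theorem circleIncl_notMem_fatouSet {x : OnePoint ℝ} (hx : x ∈ expandingSet (circleMap f)) :
    circleIncl x ∉ fatouSet (sphereMap f) := by
  intro h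
  let _ : UniformSpace (OnePoint ℂ) := uniformSpaceOfCompactR1
  have heq := equicontinuousAt_of_mem_fatouSet h
  have hne : circleIncl OnePoint.infty ≠ circleIncl (OnePoint.some 0) :=
    injective_circleIncl.ne (OnePoint.infty_ne_coe _)
  refine hne (eq_of_uniformity fun {V} hV => ?_)
  obtain ⟨W, hW, hsymm, hWV⟩ := comp_symm_mem_uniformity_sets hV
  have hev := continuous_circleIncl.continuousAt.eventually (heq W hW)
  obtain ⟨A, hAW, hA, hxA⟩ := mem_nhds_iff.1 hev
  obtain ⟨n, hn⟩ := hx A hA hxA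
  obtain ⟨a, ha, ha'⟩ : OnePoint.infty ∈ (circleMap f)^[n] '' A := hn ▸ mem_univ _
  obtain ⟨b, hb, hb'⟩ : OnePoint.some 0 ∈ (circleMap f)^[n] '' A := hn ▸ mem_univ _
  rw [← ha', ← hb', circleIncl_iterate, circleIncl_iterate]
  exact hWV (SetRel.prodMk_mem_comp (hsymm.symm _ _ (hAW ha n)) (hAW hb n))

theorem juliaSet_sphereMap (hres : (quadPair f).res < 0) :
    juliaSet (sphereMap f) = circleIncl '' expandingSet (circleMap f) := by
  ext z
  constructor
  · intro hz
    have hzr : z ∈ realCircle := by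
      by_contra hcon
      exact hz (mem_fatouSet_of_notMem_realCircle hf hres hcon)
    obtain ⟨x, rfl⟩ := hzr
    refine ⟨x, ?_, rfl⟩
    by_contra hcon
    exact hz (circleIncl_mem_fatouSet hf hres hcon)
  · rintro ⟨x, hx, rfl⟩
    exact circleIncl_notMem_fatouSet hx

theorem nonempty_expandingSet (hres : (quadPair f).res < 0) :
    (expandingSet (circleMap f)).Nonempty := by
  let u : UniformSpace (OnePoint ℂ) := uniformSpaceOfCompactR1
  let v : UniformSpace (OnePoint ℝ) := uniformSpaceOfCompactR1
  -- Uniqueness of the uniformity of a compact space lets equicontinuity on the sphere be read on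
  -- the circle.
  have hcomap : UniformSpace.comap circleIncl u = v :=
    unique_uniformity_of_compact isClosedEmbedding_circleIncl.eq_induced.symm rfl
  obtain ⟨x, hx⟩ := (isDoubleCover_circleMap hf hres).exists_not_equicontinuousAt
  by_contra hempty
  rw [not_nonempty_iff_eq_empty] at hempty
  have h1 := equicontinuousAt_of_mem_fatouSet
    (circleIncl_mem_fatouSet hf hres (x := x) (by rw [hempty]; exact notMem_empty _))
  refine hx fun V hV => ?_
  have hV' : V ∈ (UniformSpace.comap circleIncl u).uniformity := hcomap ▸ hV
  obtain ⟨W, hW, hWV⟩ := hV'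
  filter_upwards [continuous_circleIncl.continuousAt.eventually (h1 W hW)] with y hy n
  refine hWV ?_
  change (circleIncl _, circleIncl _) ∈ W
  rw [circleIncl_iterate, circleIncl_iterate]
  exact hy n

omit hf in
-- A connected subset of `J` through `x` is trapped in any arc around `x` with end points off `J`,
-- and such arcs exist arbitrarily close to `x`.
theorem isTotallyDisconnected_of_interior_eq_empty {J : Set (OnePoint ℝ)}
    (hJ : ∀ A : Set (OnePoint ℝ), IsOpen A → A.Nonempty → ¬ A ⊆ J) : IsTotallyDisconnected J := by
  intro C hCJ hC x hx y hy
  by_contra hxy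
  have he := isOpenEmbedding_proj_chart (K := ℝ) x
  obtain ⟨ρ, hρ, hρy⟩ := (hasBasis_nhds_circle x).mem_iff.1
    (isOpen_ne.mem_nhds hxy : {z | z ≠ y} ∈ 𝓝 x)
  have hpt : ∀ a b : ℝ, a < b → ∃ t ∈ Ioo a b, proj (chart ℝ x t) ∉ J := by
    intro a b hab
    obtain ⟨_, ⟨t, ht, rfl⟩, htJ⟩ := not_subset.1 (hJ _ (he.isOpenMap _ isOpen_Ioo)
      ((nonempty_Ioo.2 hab).image _))
    exact ⟨t, ht, htJ⟩
  obtain ⟨a, ha, haJ⟩ := hpt (-ρ) 0 (by linarith)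
  obtain ⟨b, hb, hbJ⟩ := hpt 0 ρ hρ
  have hsub := subset_interior_of_disjoint_frontier hC
    (N := (fun t => proj (chart ℝ x t)) '' Icc a b) (fun u hu hfr => by
      obtain ⟨t, ht, rfl⟩ := frontier_arc_subset x a b hfr
      rcases ht with rfl | rfl
      · exact haJ (hCJ hu)
      · exact hbJ (hCJ hu)) ⟨x, hx, 0, ⟨ha.2.le, hb.1.le⟩, proj_chart_zero x⟩
  obtain ⟨t, ht, hty⟩ := interior_subset (hsub hy)
  refine hρy ⟨t, ?_, rfl⟩ hty
  rw [mem_ball_zero_iff, Real.norm_eq_abs, abs_lt]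
  exact ⟨ha.1.trans_le ht.1, ht.2.trans_lt hb.2⟩

omit hf in
-- Two charts cover the circle; Brouwer's theorem needs this countability.
instance : SecondCountableTopology (OnePoint ℝ) := by
  let c : Bool → OnePoint ℝ := fun b => if b then OnePoint.infty else OnePoint.some 0
  have (b : Bool) : SecondCountableTopology (range fun t : ℝ => proj (chart ℝ (c b) t)) :=
    (isOpenEmbedding_proj_chart (c b)).isEmbedding.toHomeomorph.symm.isEmbedding.secondCountableTopology
  refine TopologicalSpace.secondCountableTopology_of_countable_cover
    (U := fun b : Bool => range fun t : ℝ => proj (chart ℝ (c b) t))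
    (fun b => (isOpenEmbedding_proj_chart (c b)).isOpen_range) ?_
  refine eq_univ_of_forall fun x => mem_iUnion.2 ?_
  induction x using OnePoint.rec with
  | infty => exact ⟨true, 0, proj_chart_zero _⟩
  | coe r =>
    refine ⟨false, r, ?_⟩
    simp [c, chart, proj_mk_one]

theorem isCantorSet_juliaSet (hres : (quadPair f).res < 0)
    (hne : expandingSet (circleMap f) ≠ univ) : IsCantorSet (juliaSet (sphereMap f)) := by
  have hdc := isDoubleCover_circleMap hf hres
  set J := expandingSet (circleMap f) with hJ
  have : CompactSpace J :=
    isCompact_iff_compactSpace.1 (IsDoubleCover.isClosed_expandingSet _).isCompact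
  have : Nonempty J := (nonempty_expandingSet hf hres).to_subtype
  have : TotallyDisconnectedSpace J := totallyDisconnectedSpace_subtype_iff.2
    (isTotallyDisconnected_of_interior_eq_empty fun A hA hA0 hAJ =>
      hne (hdc.expandingSet_eq_univ hA hA0 hAJ))
  have hperf : ∀ x : J, ¬ IsOpen {x} := by
    rintro ⟨x, hx⟩ hopen
    obtain ⟨A, hA, hAx⟩ := isOpen_induced_iff.1 hopen
    have hxA : (⟨x, hx⟩ : J) ∈ Subtype.val ⁻¹' A := hAx ▸ mem_singleton _
    obtain ⟨y, hyA, hyx, hyJ⟩ := hdc.exists_ne_mem_expandingSet hx hA hxA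
    have : (⟨y, hyJ⟩ : J) ∈ Subtype.val ⁻¹' A := hyA
    rw [hAx] at this
    exact hyx (congrArg Subtype.val this)
  obtain ⟨e⟩ := nonempty_homeomorph_cantorSpace hperf
  rw [juliaSet_sphereMap hf hres]
  exact ⟨((isClosedEmbedding_circleIncl.isEmbedding.homeomorphImage J).symm.trans e).trans
    cantorSetHomeomorphNatToBool.symm⟩

end Julia

end RealQuadratic

theorem mainTheorem10 (f : RatFunc ℝ) (hf : RealQuadratic.mapDegree f = 2) :
    (Function.Surjective (RealQuadratic.circleMap f) ↔
      ∀ c : OnePoint ℂ, RealQuadratic.IsCriticalPoint (RealQuadratic.sphereMap f) c →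
        ∀ n : ℕ, (RealQuadratic.sphereMap f)^[n] c ∉ RealQuadratic.realCircle) ∧
    (Function.Surjective (RealQuadratic.circleMap f) ↔
      IsCoveringMap (RealQuadratic.circleMap f)) ∧
    (Function.Surjective (RealQuadratic.circleMap f) →
      (RealQuadratic.juliaSet (RealQuadratic.sphereMap f) = RealQuadratic.realCircle ∨
        (RealQuadratic.juliaSet (RealQuadratic.sphereMap f) ⊆ RealQuadratic.realCircle ∧
          RealQuadratic.IsCantorSet (RealQuadratic.juliaSet (RealQuadratic.sphereMap f)))) ∧
      RealQuadratic.realEntropy f = ((Real.log 2 : ℝ) : EReal)) := by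
  refine ⟨RealQuadratic.surjective_iff_critical hf, RealQuadratic.isCoveringMap_iff hf,
    fun hs => ?_⟩
  have hres := (RealQuadratic.surjective_circleMap_iff hf).1 hs
  refine ⟨?_, (RealQuadratic.isDoubleCover_circleMap hf hres).topEntropy_eq_log_two⟩
  by_cases h : RealQuadratic.expandingSet (RealQuadratic.circleMap f) = univ
  · left
    rw [RealQuadratic.juliaSet_sphereMap hf hres, h, image_univ]
    rfl
  · right
    refine ⟨?_, RealQuadratic.isCantorSet_juliaSet hf hres h⟩
    rw [RealQuadratic.juliaSet_sphereMap hf hres]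
    exact image_subset_range _ _
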